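/- Let $\tau_R\in\mathbb R$ and $\tau_L,\delta_L,\delta_R>0$, and put $$f_L(x,y)=(\tau_L x+y+1,\,-\delta_L x),\qquad f_R(x,y)=(\tau_R x+y+1,\,-\delta_R x),$$ and let $f:\mathbb R^2\to\mathbb R^2$ be equal to $f_L$ for $x\le 0$ and to $f_R$ for $x\ge 0$. Let $\Sigma=\{x=0\}$, $\Pi_L=\{x\le0\}$, $\Pi_R=\{x\ge0\}$, $\Phi=\{(x,y): x<0,\ y\le0\}$, $\Phi_{\rm pre}=\bigcup_{n\ge1}f^{-n}(\Phi)$ and $\Phi_0=\Phi_{\rm pre}\cap\Phi$. The induced map $F:\Phi_0\to\Phi$ is $F(Z)=f^n(Z)$ for the smallest $n\ge1$ with $f^n(Z)\in\Phi$. Let $\chi_L(Z)$ be the smallest $i\ge1$ with $f^i(Z)\notin\Pi_L$ and $\chi_R(Z)$ the smallest $j\ge1$ with $f^j(Z)\notin\Pi_R$, when they exist. When the line $f_L^{-i}(\Sigma)$ is not vertical, write it as $\{y=m_ix+c_i\}$; let $p^*\in\mathbb N\cup\{\infty\}$ be the smallest $i\ge1$ with $m_i\ge0$ ($\infty$ if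 there is none). Let $1\le p_{\min}<p_{\max}\le p^*$ be integers ($p_{\max}<\infty$), let $S=(0,c_{p_{\max}})$, $T=(0,c_{p_{\min}})$, and $$\Omega=\Big\{(x,y)\in\Phi:\ \tfrac{c_{p_{\max}}+1}{c_{p_{\max}}}(c_{p_{\max}}-y)\le x\le\tfrac{c_{p_{\min}}+1}{c_{p_{\min}}}(c_{p_{\min}}-y)\Big\}.$$ For $W\in\{S,T\}$ (which is not in $\Phi$) let $F(W)=f_R^{q}(f_L^{p}(W))$ with $p=\chi_L(W)$, $q=\chi_R(f_L^{p}(W))$. Assume: * $f(S),f(T)\in\Phi_{\rm pre}$; * $\pi_2(U)>\pi_2(S)$ and $\pi_2(V)<\pi_2(T)$, where $U$ (respectively $V$) is the point at which the line through $F(S)$ and $f^{-1}(F(S))$ (respectively through $F(T)$ and $f^{-1}(F(T))$) meets $\Sigma$; * $\pi_1(f(S))\pi_2(F(S))+\pi_2(S)\pi_1(F(S))<\pi_1(f(S))\pi_2(S)$; * $\pi_1(f(T))\pi_2(F(T))+\pi_2(T)\pi_1(F(T))>\pi_1(f(T))\pi_2(T)$. Let $C$ be the topological quotient of the closed third quadrant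 ${\rm cl}(\Phi)=\{x\le0,\ y\le0\}$ in which, for each $c_{p_{\max}}\le y\le c_{p_{\min}}$, the point $(0,y)$ is identified with its image $f(0,y)=(y+1,0)$. The cylindrical topology on $\Omega$ is the one $\Omega$ inherits as a subset of $C$, and ${\rm int}(\Omega)$ is its interior in $C$. Then $\Omega\subseteq\Phi_0$ and $F(\Omega)\subseteq\Omega$, the map $F:\Omega\to\Omega$ is continuous in the cylindrical topology, and $F(\Omega)\subset{\rm int}(\Omega)$. (In this sense $\Omega$ is a trapping region for $F$.) -/

import Mathlib

open Set Topology

/-- Parameters of the two-dimensional border-collision normal form (with `μ = 1`). -/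
structure BCNF where
  τL : ℝ
  δL : ℝ
  τR : ℝ
  δR : ℝ

namespace BCNF

noncomputable section

/-- Left affine piece `Z ↦ A_L Z + (1,0)`, with `A_L = [[τL, 1], [-δL, 0]]`. -/
def fL (P : BCNF) (Z : ℝ × ℝ) : ℝ × ℝ := (P.τL * Z.1 + Z.2 + 1, -P.δL * Z.1)

/-- Right affine piece `Z ↦ A_R Z + (1,0)`, with `A_R = [[τR, 1], [-δR, 0]]`. -/
def fR (P : BCNF) (Z : ℝ × ℝ) : ℝ × ℝ := (P.τR * Z.1 + Z.2 + 1, -P.δR * Z.1)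

open Classical in
/-- The piecewise-affine map (the two pieces agree on `x = 0`). -/
def f (P : BCNF) (Z : ℝ × ℝ) : ℝ × ℝ := if Z.1 ≤ 0 then P.fL Z else P.fR Z

/-- The switching manifold, i.e. the `y`-axis. -/
def switching : Set (ℝ × ℝ) := {Z | Z.1 = 0}

/-- The closed third quadrant. -/
def Q3 : Set (ℝ × ℝ) := {Z | Z.1 ≤ 0 ∧ Z.2 ≤ 0}

/-- `Φ`: the closed third quadrant without the switching manifold. -/
def Phi : Set (ℝ × ℝ) := {Z | Z.1 < 0 ∧ Z.2 ≤ 0}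

/-- `Φ_pre = ⋃_{n ≥ 1} f^{-n}(Φ)`. -/
def PhiPre (P : BCNF) : Set (ℝ × ℝ) := {Z | ∃ n : ℕ, 1 ≤ n ∧ P.f^[n] Z ∈ Phi}

/-- `Φ₀ = Φ_pre ∩ Φ`, the domain of the induced map. -/
def Phi0 (P : BCNF) : Set (ℝ × ℝ) := P.PhiPre ∩ Phi

/-- The smallest `n ≥ 1` with `f^n(Z) ∈ Φ` (meaningful for `Z ∈ Φ_pre`). -/
def returnTime (P : BCNF) (Z : ℝ × ℝ) : ℕ := sInf {n : ℕ | 1 ≤ n ∧ P.f^[n] Z ∈ Phi}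

/-- The induced map `F`, whose domain is `Φ₀`; outside it the value carries no meaning. -/
def F (P : BCNF) (Z : ℝ × ℝ) : ℝ × ℝ := P.f^[P.returnTime Z] Z

/-- Closed left half-plane. -/
def PiL : Set (ℝ × ℝ) := {Z | Z.1 ≤ 0}

/-- Closed right half-plane. -/
def PiR : Set (ℝ × ℝ) := {Z | 0 ≤ Z.1}

/-- The smallest `i ≥ 1` with `f^i(Z) ∉ Π_L` (if there is one). -/
def chiL (P : BCNF) (Z : ℝ × ℝ) : ℕ := sInf {i : ℕ | 1 ≤ i ∧ P.f^[i] Z ∉ PiL}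

/-- The smallest `j ≥ 1` with `f^j(Z) ∉ Π_R` (if there is one). -/
def chiR (P : BCNF) (Z : ℝ × ℝ) : ℕ := sInf {j : ℕ | 1 ≤ j ∧ P.f^[j] Z ∉ PiR}

/-- `f_R^q (f_L^p (Z))` with `p = χ_L(Z)` and `q = χ_R(f_L^p(Z))`. On `Φ₀` this is `F(Z)`; it also
gives the meaning of `F(S)` and `F(T)` for the points `S`, `T` of the switching manifold, which do
not belong to `Φ` (it is the point where the orbit first leaves `Π_R` after having left `Π_L`). -/
def Fpq (P : BCNF) (Z : ℝ × ℝ) : ℝ × ℝ :=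
  P.fR^[P.chiR (P.fL^[P.chiL Z] Z)] (P.fL^[P.chiL Z] Z)

/-- The first component of `f_L^i (x, y)` is `lineA i * x + lineB i * y + lineK i`. -/
def lineK (P : BCNF) (i : ℕ) : ℝ := (P.fL^[i] (0, 0)).1

/-- Coefficient of `x` in the first component of `f_L^i (x, y)`. -/
def lineA (P : BCNF) (i : ℕ) : ℝ := (P.fL^[i] (1, 0)).1 - (P.fL^[i] (0, 0)).1

/-- Coefficient of `y` in the first component of `f_L^i (x, y)`. -/
def lineB (P : BCNF) (i : ℕ) : ℝ := (P.fL^[i] (0, 1)).1 - (P.fL^[i] (0, 0)).1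

/-- Slope `m_i` of the line `f_L^{-i}(Σ)`, when that line is not vertical (`lineB i ≠ 0`). -/
def slope (P : BCNF) (i : ℕ) : ℝ := -P.lineA i / P.lineB i

/-- The `y`-intercept `c_i` of the line `f_L^{-i}(Σ)`, when that line is not vertical. -/
def intercept (P : BCNF) (i : ℕ) : ℝ := -P.lineK i / P.lineB i

theorem fL_iterate_affine (P : BCNF) (i : ℕ) (x y : ℝ) :
    P.fL^[i] (x, y) =
      (1 - x - y) • P.fL^[i] (0, 0) + x • P.fL^[i] (1, 0) + y • P.fL^[i] (0, 1) := by
  induction i with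
  | zero => ext <;> simp
  | succ n ih =>
    simp only [Function.iterate_succ_apply', ih]
    ext <;> simp [fL] <;> ring

/-- The defining property of `m_i` and `c_i`. -/
theorem preimage_switching (P : BCNF) (i : ℕ) (h : P.lineB i ≠ 0) :
    P.fL^[i] ⁻¹' switching = {Z | Z.2 = P.slope i * Z.1 + P.intercept i} := by
  ext ⟨x, y⟩
  have e : (P.fL^[i] (x, y)).1 = P.lineA i * x + P.lineB i * y + P.lineK i := by
    rw [fL_iterate_affine]
    simp [lineA, lineB, lineK]
    ring
  simp only [switching, mem_preimage, mem_ofPred_eq, e, slope, intercept]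
  field_simp
  constructor <;> intro h <;> linarith

/-- `p*`: the smallest `i ≥ 1` with `m_i ≥ 0` (`⊤` if there is none). -/
def pStar (P : BCNF) : ℕ∞ :=
  sInf {i : ℕ∞ | ∃ k : ℕ, i = k ∧ 1 ≤ k ∧ P.lineB k ≠ 0 ∧ 0 ≤ P.slope k}

/-- The point `(0, c_p)`; thus `S = axisPt pmax` and `T = axisPt pmin`. -/
def axisPt (P : BCNF) (p : ℕ) : ℝ × ℝ := (0, P.intercept p)

/-- The region `Ω`. -/
def Omega (P : BCNF) (pmin pmax : ℕ) : Set (ℝ × ℝ) :=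
  {Z | Z ∈ Phi ∧
    (P.intercept pmax + 1) / P.intercept pmax * (P.intercept pmax - Z.2) ≤ Z.1 ∧
    Z.1 ≤ (P.intercept pmin + 1) / P.intercept pmin * (P.intercept pmin - Z.2)}

theorem Omega_subset_Q3 (P : BCNF) (pmin pmax : ℕ) : P.Omega pmin pmax ⊆ Q3 :=
  fun _ h => ⟨h.1.1.le, h.1.2⟩

/-- `U` is a point at which the line through `X` and `f⁻¹(X)` meets the switching manifold. -/
def IsCrossing (P : BCNF) (X U : ℝ × ℝ) : Prop :=
  ∃ X' : ℝ × ℝ, P.f X' = X ∧ U ∈ line[ℝ, X, X'] ∧ U ∈ switching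

/-- The identification of `(0, y)` with `f(0, y)`, for `c_pmax ≤ y ≤ c_pmin`. -/
def glue (P : BCNF) (pmin pmax : ℕ) (X Y : Q3) : Prop :=
  X.1 ∈ switching ∧ P.intercept pmax ≤ X.1.2 ∧ X.1.2 ≤ P.intercept pmin ∧ Y.1 = P.f X.1

/-- The closed third quadrant (the closure of `Φ`), with each `(0, y)`, `c_pmax ≤ y ≤ c_pmin`,
identified with `f(0, y)`, and with the quotient topology. -/
abbrev Cyl (P : BCNF) (pmin pmax : ℕ) : Type := Quot (P.glue pmin pmax)

/-- The quotient map. -/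
def toCyl (P : BCNF) (pmin pmax : ℕ) (X : Q3) : P.Cyl pmin pmax := Quot.mk _ X

/-- `Ω` as a subset of the quotient. -/
def OmegaCyl (P : BCNF) (pmin pmax : ℕ) : Set (P.Cyl pmin pmax) :=
  P.toCyl pmin pmax '' {X : Q3 | X.1 ∈ P.Omega pmin pmax}

/-- The cylindrical topology on `Ω`: the topology it inherits as a subset of the quotient. -/
@[reducible]
def cylTopology (P : BCNF) (pmin pmax : ℕ) : TopologicalSpace (P.Omega pmin pmax) :=
  TopologicalSpace.induced
    (fun Z => P.toCyl pmin pmax ⟨Z.1, P.Omega_subset_Q3 pmin pmax Z.2⟩) inferInstance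

end

end BCNF

/-! Call the line through (0,c) and f(0,c) = (c+1,0) the chord at c. The affine function `chord c`
vanishes on it and, for c < -1, is negative at the origin. Ω is the part of Φ between the chords at
c_pmax and c_pmin. The core claim is that its points return to Φ strictly between these chords
(`Omega_return`).

Left half: `coefB` is positive up to index p_max, so the intercepts c_i decrease while the levels,
the ordinates of f_L^i(0,c_i), increase, and f_L^i sends the chord at c_i to the chord at its level.
A point of Ω therefore enters x > 0 between the chords at the levels of T and S (`left_passage`), on
a segment from (0,w) to (w+1,0) with w between these levels (`exists_strip_coord`).

Right half: iterates of that segment join consecutive iterates of (0,w). If the orbit of (0,w)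
crosses the axis at (0,v) and first lands in x < 0 at X, then points of the segment leave x ≥ 0 onto
the path (0,v), X, (v+1,0) (`IsExit.exit_point`). A larger w leaves no later and crosses no higher
(`IsExit.cross_le`), so v lies between the ordinates of U and V, hence strictly between c_pmax and
c_pmin. The corner X is beyond the inner chord because the orbit turns clockwise
(`chord_nonneg_of_cross`), and within the outer chord because that property passes from S to smaller
w (`IsExit.inside`).

Topology: the return time can jump only where the orbit meets the glued part of the axis, and there
the two candidate images are the same point of C. The strict chord inequalities give a saturated
open set inside Ω, hence interior points. -/

namespace BCNF

/-! ### Iterates of an affine map in companion form -/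

/-- The affine map `(x, y) ↦ (τ x + y + 1, -δ x)`. -/
def lin (τ δ : ℝ) (Z : ℝ × ℝ) : ℝ × ℝ := (τ * Z.1 + Z.2 + 1, -δ * Z.1)

/-- The fundamental solution of `u (n + 2) = τ u (n + 1) - δ u n`. -/
def coefB (τ δ : ℝ) : ℕ → ℝ
  | 0 => 0
  | 1 => 1
  | n + 2 => τ * coefB τ δ (n + 1) - δ * coefB τ δ n

/-- Partial sums of `coefB`. -/
def coefK (τ δ : ℝ) : ℕ → ℝ
  | 0 => 0
  | n + 1 => coefK τ δ n + coefB τ δ (n + 1)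

/-- First component of the `n`-th iterate of `(0, w)` under `lin τ δ`. -/
def axisX (τ δ : ℝ) (n : ℕ) (w : ℝ) : ℝ := coefB τ δ n * w + coefK τ δ n

section recurrence

variable (τ δ : ℝ)

theorem coefB_add_two (n : ℕ) :
    coefB τ δ (n + 2) = τ * coefB τ δ (n + 1) - δ * coefB τ δ n := by
  rw [coefB]

theorem coefK_succ (n : ℕ) : coefK τ δ (n + 1) = coefK τ δ n + coefB τ δ (n + 1) := rfl

theorem coefK_add_two (n : ℕ) :
    coefK τ δ (n + 2) = τ * coefK τ δ (n + 1) - δ * coefK τ δ n + 1 := by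
  induction n with
  | zero => simp [coefK, coefB]; ring
  | succ n ih =>
    have h1 := coefK_succ τ δ (n + 2)
    have h2 := coefB_add_two τ δ (n + 1)
    have h3 := coefK_succ τ δ (n + 1)
    have h4 := coefK_succ τ δ n
    linear_combination h1 + ih + h2 - τ * h3 + δ * h4

/-- A discrete Wronskian: each step multiplies it by the determinant δ. It supplies the signs in
most later identities. -/
theorem coefB_wronskian (n : ℕ) :
    coefB τ δ (n + 1) ^ 2 - coefB τ δ n * coefB τ δ (n + 2) = δ ^ n := by
  induction n with
  | zero => simp [coefB]
  | succ n ih =>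
    have h2 := coefB_add_two τ δ (n + 1)
    have h1 := coefB_add_two τ δ n
    rw [show δ ^ (n + 1) = δ ^ n * δ from pow_succ δ n, ← ih]
    linear_combination (-coefB τ δ (n + 1)) * h2 + coefB τ δ (n + 2) * h1

theorem axisX_zero (w : ℝ) : axisX τ δ 0 w = 0 := by simp [axisX, coefB, coefK]

theorem axisX_one (w : ℝ) : axisX τ δ 1 w = w + 1 := by simp [axisX, coefB, coefK]

theorem axisX_add_two (n : ℕ) (w : ℝ) :
    axisX τ δ (n + 2) w = τ * axisX τ δ (n + 1) w - δ * axisX τ δ n w + 1 := by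
  simp only [axisX, coefB_add_two, coefK_add_two]
  ring

theorem axisX_sub (n : ℕ) (w w' : ℝ) :
    axisX τ δ n w' = axisX τ δ n w + (w' - w) * coefB τ δ n := by
  simp only [axisX]; ring

theorem axisX_succ_sub (n : ℕ) (w : ℝ) :
    axisX τ δ (n + 1) w - axisX τ δ n w = coefB τ δ (n + 1) * (w + 1) - coefB τ δ n * w := by
  simp only [axisX, coefK_succ]; ring

theorem axisX_succ_eq (n : ℕ) (w : ℝ) :
    axisX τ δ (n + 1) w = (1 + w) * coefK τ δ (n + 1) - w * coefK τ δ n := by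
  simp only [axisX, coefK_succ]; ring

theorem lin_iterate_fst (n : ℕ) (x y : ℝ) :
    ((lin τ δ)^[n] (x, y)).1 = coefB τ δ (n + 1) * x + coefB τ δ n * y + coefK τ δ n ∧
    ((lin τ δ)^[n + 1] (x, y)).1 =
      coefB τ δ (n + 2) * x + coefB τ δ (n + 1) * y + coefK τ δ (n + 1) := by
  induction n with
  | zero => simp [coefB, coefK, lin]
  | succ n ih =>
    refine ⟨ih.2, ?_⟩
    have e : ((lin τ δ)^[n + 2] (x, y)).1 =
        τ * ((lin τ δ)^[n + 1] (x, y)).1 - δ * ((lin τ δ)^[n] (x, y)).1 + 1 := by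
      rw [Function.iterate_succ_apply', Function.iterate_succ_apply']
      simp only [lin]; ring
    rw [e, ih.1, ih.2, coefB_add_two τ δ (n + 1), coefK_add_two τ δ n]
    linear_combination y * (-coefB_add_two τ δ n)

theorem lin_iterate_snd (n : ℕ) (Z : ℝ × ℝ) :
    ((lin τ δ)^[n + 1] Z).2 = -δ * ((lin τ δ)^[n] Z).1 := by
  rw [Function.iterate_succ_apply']; rfl

theorem lin_iterate_axis (n : ℕ) (w : ℝ) : ((lin τ δ)^[n] (0, w)).1 = axisX τ δ n w := by
  rw [(lin_iterate_fst τ δ n 0 w).1, axisX]; ring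

theorem lin_iterate_det (n : ℕ) (X Y Z : ℝ × ℝ) :
    (((lin τ δ)^[n] Y).1 - ((lin τ δ)^[n] X).1) * (((lin τ δ)^[n] Z).2 - ((lin τ δ)^[n] X).2) -
      (((lin τ δ)^[n] Y).2 - ((lin τ δ)^[n] X).2) * (((lin τ δ)^[n] Z).1 - ((lin τ δ)^[n] X).1) =
    δ ^ n * ((Y.1 - X.1) * (Z.2 - X.2) - (Y.2 - X.2) * (Z.1 - X.1)) := by
  induction n with
  | zero => simp
  | succ n ih =>
    simp only [Function.iterate_succ_apply']
    rw [pow_succ, mul_right_comm, ← ih]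
    simp only [lin]
    ring

end recurrence

/-! ### Spirals of the right half-map -/

/-- `(w, N)`: the orbit of `(0, w)` under `lin τ δ` first leaves `x ≥ 0` at time `N`. -/
def IsExit (τ δ w : ℝ) (N : ℕ) : Prop := (∀ i < N, 0 ≤ axisX τ δ i w) ∧ axisX τ δ N w < 0

/-- The segment between the iterates `m + 1` and `m + 2` of `(0, w)` meets the `y`-axis at
`(0, v)`, at parameter `t`. -/
def CrossAt (τ δ w : ℝ) (m : ℕ) (t v : ℝ) : Prop :=
  0 ≤ t ∧ t ≤ 1 ∧ (1 - t) * axisX τ δ (m + 1) w + t * axisX τ δ (m + 2) w = 0 ∧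
    v = -δ * ((1 - t) * axisX τ δ m w + t * axisX τ δ (m + 1) w)

/-- Affine function vanishing on the line through `(0, c)` and `(c + 1, 0)`. -/
def chord (c : ℝ) (Z : ℝ × ℝ) : ℝ := (c + 1) * Z.2 + c * Z.1 - c * (c + 1)

section spiral

/-! ### Exit times and contacts with the axis -/

variable {τ δ : ℝ}

/-- At a first negative `coefK` the increment `coefB` would be negative too, and then so would
`axisX`, as w ≥ 0. -/
theorem coefK_nonneg {w : ℝ} (hw : 0 ≤ w) {n : ℕ} (h : ∀ i < n, 0 ≤ axisX τ δ i w) :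
    ∀ i < n, 0 ≤ coefK τ δ i := by
  intro i
  induction i with
  | zero => intro _; simp [coefK]
  | succ i ih =>
    intro hi
    have h0 := ih (by omega)
    have h1 := h _ hi
    by_contra! hK
    simp only [axisX, coefK_succ] at h1 hK
    nlinarith

theorem IsExit.coefB_nonpos {w : ℝ} (hw : 0 ≤ w) {N : ℕ} (h : IsExit τ δ w N) :
    coefB τ δ N ≤ 0 := by
  obtain _ | n := N
  · simp [coefB]
  have h0 := coefK_nonneg hw h.1 n (by omega)
  have h1 := h.2
  simp only [axisX, coefK_succ] at h1
  by_contra! hB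
  nlinarith [mul_nonneg hB.le hw]

theorem IsExit.mono {w w' : ℝ} (hw : 0 ≤ w) {N : ℕ} (h : IsExit τ δ w N) (hww : w ≤ w') :
    axisX τ δ N w' < 0 := by
  have := h.coefB_nonpos hw
  have h2 := h.2
  rw [axisX_sub τ δ N w w']
  nlinarith

theorem IsExit.two_le {w : ℝ} (hw : 0 ≤ w) {N : ℕ} (h : IsExit τ δ w N) : 2 ≤ N := by
  obtain _ | _ | n := N
  · exact absurd h.2 (by simp [axisX_zero])
  · have := h.2
    rw [zero_add, axisX_one] at this
    linarith
  · omega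

theorem axisX_shift {d : ℝ} {j : ℕ} (h : axisX τ δ (j + 1) d = 0) (i : ℕ) :
    axisX τ δ (j + 1 + i) d = axisX τ δ i (-δ * axisX τ δ j d) ∧
    axisX τ δ (j + 1 + i + 1) d = axisX τ δ (i + 1) (-δ * axisX τ δ j d) := by
  induction i with
  | zero =>
    refine ⟨by rw [add_zero, h, axisX_zero], ?_⟩
    rw [add_zero, axisX_add_two, h, zero_add, axisX_one]; ring
  | succ i ih =>
    refine ⟨ih.2, ?_⟩
    have e := axisX_add_two τ δ (j + 1 + i) d
    rw [ih.1, ih.2, ← axisX_add_two] at e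
    exact e

/-- If the contact ordinate v were in [-1,0], every later abscissa (1+v)K_{i+1} - vK_i would be
nonnegative and the orbit could not leave. -/
theorem touch_lt {d : ℝ} (hδ : 0 < δ) {j N : ℕ} (hK : ∀ i < N, 0 ≤ coefK τ δ i)
    (hj : axisX τ δ (j + 1) d = 0) (hj0 : 0 ≤ axisX τ δ j d) (hjN : j + 1 ≤ N)
    (hN : axisX τ δ N d < 0) : -δ * axisX τ δ j d < -1 := by
  obtain ⟨i, rfl⟩ := Nat.exists_eq_add_of_le hjN
  rw [(axisX_shift hj i).1] at hN
  set v := -δ * axisX τ δ j d with hv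
  have hv0 : v ≤ 0 := by rw [hv]; nlinarith
  obtain _ | i := i
  · exact absurd hN (by simp [axisX_zero])
  rw [axisX_succ_eq] at hN
  have h1 := hK (i + 1) (by omega)
  have h2 := hK i (by omega)
  by_contra! hv1
  nlinarith [mul_nonneg (by linarith : 0 ≤ 1 + v) h1, mul_nonneg (by linarith : 0 ≤ -v) h2]

/-- A contact at (0,v) has v < -1, so the next abscissa v + 1 is already negative. -/
theorem IsExit.touch_last {w : ℝ} (hδ : 0 < δ) (hw : 0 ≤ w) {N j : ℕ} (h : IsExit τ δ w N)
    (hj : axisX τ δ (j + 1) w = 0) (hjN : j + 1 < N) : N = j + 2 := by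
  have hv := touch_lt hδ (coefK_nonneg hw h.1) hj (h.1 _ (by omega)) hjN.le h.2
  have e := axisX_add_two τ δ j w
  rw [hj] at e
  by_contra hne
  have := h.1 (j + 2) (by omega)
  linarith

theorem CrossAt.mono {w w' t t' v v' : ℝ} (hδ : 0 < δ) {m : ℕ} (hw : 0 ≤ w) (hww : w ≤ w')
    (h : CrossAt τ δ w m t v) (h' : CrossAt τ δ w' m t' v')
    (hd : axisX τ δ (m + 2) w' < axisX τ δ (m + 1) w') : v' ≤ v := by
  obtain ⟨ht0, ht1, e1, e2⟩ := h
  obtain ⟨-, -, e1', e2'⟩ := h'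
  have s1 := axisX_sub τ δ m w w'
  have s2 := axisX_sub τ δ (m + 1) w w'
  have s3 := axisX_sub τ δ (m + 2) w w'
  have d1 := axisX_succ_sub τ δ (m + 1) w'
  have d0 := axisX_succ_sub τ δ m w'
  have W := coefB_wronskian τ δ m
  -- Eliminating t' - t between the two crossing equations leaves the Wronskian. The right side is
  -- nonnegative because t ≤ 1 ≤ w' + 1.
  have key : (v' - v) * (axisX τ δ (m + 2) w' - axisX τ δ (m + 1) w') =
      (w' - w) * δ ^ (m + 1) * (w' + 1 - t) := by
    have hx : (w' - w) * ((1 - t) * coefB τ δ (m + 1) + t * coefB τ δ (m + 2)) +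
        (t' - t) * (axisX τ δ (m + 2) w' - axisX τ δ (m + 1) w') = 0 := by
      linear_combination e1' - e1 - (1 - t) * s2 - t * s3
    have hy : v' - v = -δ * (w' - w) * ((1 - t) * coefB τ δ m + t * coefB τ δ (m + 1)) -
        (t' - t) * δ * (axisX τ δ (m + 1) w' - axisX τ δ m w') := by
      linear_combination e2' - e2 - δ * (1 - t) * s1 - δ * t * s2
    rw [pow_succ, ← W, hy]
    have : (t' - t) * (axisX τ δ (m + 2) w' - axisX τ δ (m + 1) w') =
      - ((w' - w) * ((1 - t) * coefB τ δ (m + 1) + t * coefB τ δ (m + 2))) := by linarith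
    linear_combination (-δ * (axisX τ δ (m + 1) w' - axisX τ δ m w')) * this +
      (-δ * (w' - w) * ((1 - t) * coefB τ δ m + t * coefB τ δ (m + 1))) * d1 +
      (δ * (w' - w) * ((1 - t) * coefB τ δ (m + 1) + t * coefB τ δ (m + 2))) * d0
  have hr : 0 ≤ (w' - w) * δ ^ (m + 1) * (w' + 1 - t) := by
    have := pow_pos hδ (m + 1)
    apply mul_nonneg (mul_nonneg (by linarith) this.le); linarith
  by_contra! hlt
  nlinarith

theorem exists_axisX_root {w w' : ℝ} {n : ℕ} (hww : w ≤ w') (h : 0 ≤ axisX τ δ n w)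
    (h' : axisX τ δ n w' ≤ 0) : ∃ d, w ≤ d ∧ d ≤ w' ∧ axisX τ δ n d = 0 := by
  have hc : ContinuousOn (axisX τ δ n) (Icc w w') := by unfold axisX; fun_prop
  obtain ⟨d, hd, e⟩ := intermediate_value_Icc' hww hc ⟨h', h⟩
  exact ⟨d, hd.1, hd.2, e⟩

theorem axisX_nonneg_between {w w' d : ℝ} {n : ℕ} (h1 : w ≤ d) (h2 : d ≤ w')
    (h : 0 ≤ axisX τ δ n w) (h' : 0 ≤ axisX τ δ n w') : 0 ≤ axisX τ δ n d := by
  simp only [axisX] at *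
  rcases le_total 0 (coefB τ δ n) with hB | hB <;> nlinarith

theorem IsExit.exists_crossAt {w : ℝ} {m : ℕ} (h : IsExit τ δ w (m + 2)) :
    ∃ t v, t < 1 ∧ CrossAt τ δ w m t v := by
  have h1 := h.1 (m + 1) (by omega)
  have h2 := h.2
  have hp : 0 < axisX τ δ (m + 1) w - axisX τ δ (m + 2) w := by linarith
  refine ⟨axisX τ δ (m + 1) w / (axisX τ δ (m + 1) w - axisX τ δ (m + 2) w), _, ?_, ?_, ?_, ?_,
    rfl⟩
  · rw [div_lt_one hp]; linarith
  · positivity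
  · rw [div_le_one hp]; linarith
  · field_simp; ring

/-- The exit index falls as w grows. Going down from w', one meets a value d at each change of
index, where the orbit touches the axis one step before leaving; this links crossings with different
indices. -/
theorem IsExit.exists_transition (hδ : 0 < δ) {w : ℝ} (hw : 0 ≤ w) {m : ℕ}
    (h : IsExit τ δ w (m + 2)) (k : ℕ) : ∀ {w' : ℝ} {m' : ℕ}, m = m' + k → w ≤ w' →
    IsExit τ δ w' (m' + 2) →
    ∃ d, w ≤ d ∧ d ≤ w' ∧ IsExit τ δ d (m + 2) ∧ (d = w' ∧ m' = m ∨ axisX τ δ (m + 1) d = 0 ∧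
      ∀ t' v', CrossAt τ δ w' m' t' v' → v' ≤ -δ * axisX τ δ m d) := by
  induction k with
  | zero =>
    rintro w' m' rfl hww h'
    exact ⟨w', hww, le_rfl, h', Or.inl ⟨rfl, rfl⟩⟩
  | succ k ih =>
    intro w' m' hm hww h'
    obtain ⟨d, hwd, hdw, hd⟩ := exists_axisX_root hww (h.1 (m' + 2) (by omega)) h'.2.le
    have hd0 : 0 ≤ axisX τ δ (m' + 1) d :=
      axisX_nonneg_between hwd hdw (h.1 _ (by omega)) (h'.1 _ (by omega))
    have hv := touch_lt hδ (coefK_nonneg hw h.1) hd hd0 (by omega) (h.mono hw hwd)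
    have hE : IsExit τ δ d (m' + 1 + 2) := by
      constructor
      · intro i hi
        obtain hi | rfl := Nat.lt_succ_iff_lt_or_eq.1 hi
        · exact axisX_nonneg_between hwd hdw (h.1 _ (by omega)) (h'.1 _ (by omega))
        · exact hd.ge
      · have e := axisX_add_two τ δ (m' + 1) d
        rw [hd] at e
        linarith
    -- The contact is the end (parameter 1) of one edge and the start (parameter 0) of the next, so
    -- it serves as a crossing for both indices.
    have hC : CrossAt τ δ d m' 1 (-δ * axisX τ δ (m' + 1) d) :=
      ⟨by norm_num, le_rfl, by simpa using hd, by ring⟩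
    have hC' : CrossAt τ δ d (m' + 1) 0 (-δ * axisX τ δ (m' + 1) d) :=
      ⟨le_rfl, by norm_num, by simpa using hd, by ring⟩
    have hmono : ∀ t' v', CrossAt τ δ w' m' t' v' → v' ≤ -δ * axisX τ δ (m' + 1) d :=
      fun t' v' hc => hC.mono hδ (hw.trans hwd) hdw hc
        (lt_of_lt_of_le h'.2 (h'.1 _ (by omega)))
    obtain ⟨d', h1, h2, h3, h4⟩ := ih (m' := m' + 1) (by omega) hwd hE
    refine ⟨d', h1, h2.trans hdw, h3, Or.inr ?_⟩
    rcases h4 with ⟨rfl, rfl⟩ | ⟨h5, h6⟩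
    · exact ⟨hd, hmono⟩
    · exact ⟨h5, fun t' v' hc => (hmono t' v' hc).trans (h6 _ _ hC')⟩

theorem IsExit.index_le {w w' : ℝ} (hw : 0 ≤ w) {N N' : ℕ} (h : IsExit τ δ w N)
    (hww : w ≤ w') (h' : IsExit τ δ w' N') : N' ≤ N := by
  by_contra! hlt
  exact absurd (h'.1 _ hlt) (not_le.2 (h.mono hw hww))

theorem IsExit.cross_le (hδ : 0 < δ) {w w' : ℝ} (hw : 0 ≤ w) {m m' : ℕ}
    (h : IsExit τ δ w (m + 2)) (hww : w ≤ w') (h' : IsExit τ δ w' (m' + 2)) {t t' v v' : ℝ}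
    (hc : CrossAt τ δ w m t v) (hc' : CrossAt τ δ w' m' t' v') : v' ≤ v := by
  obtain ⟨k, hk⟩ := Nat.exists_eq_add_of_le (h.index_le hw hww h')
  obtain ⟨d, h1, h2, h3, ⟨rfl, rfl⟩ | ⟨h4, h5⟩⟩ :=
    h.exists_transition hδ hw k (m' := m') (by omega) hww h'
  · exact hc.mono hδ hw h1 hc' (lt_of_lt_of_le h'.2 (h'.1 _ (by omega)))
  · refine (h5 _ _ hc').trans ?_
    refine hc.mono hδ hw h1 (t' := 0) ⟨le_rfl, by norm_num, by simpa using h4, by ring⟩ ?_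
    rw [h4]; exact h3.2

/-- Displacements evolve linearly, so the determinant of two consecutive ones scales by δ.
Positivity of the left side means a clockwise turn. -/
theorem spiral_turn (n : ℕ) (w : ℝ) :
    (axisX τ δ (n + 2) w - axisX τ δ (n + 1) w) ^ 2 -
      (axisX τ δ (n + 1) w - axisX τ δ n w) * (axisX τ δ (n + 3) w - axisX τ δ (n + 2) w) =
    δ ^ n * (δ * (w + 1) ^ 2 - τ * w * (w + 1) + w ^ 2) := by
  induction n with
  | zero =>
    simp only [axisX_add_two, zero_add, axisX_zero, axisX_one]; ring
  | succ n ih =>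
    rw [show δ ^ (n + 1) = δ * δ ^ n from pow_succ' δ n, mul_assoc, ← ih]
    have h3 : axisX τ δ (n + 4) w = _ := axisX_add_two τ δ (n + 2) w
    have h2 : axisX τ δ (n + 3) w = _ := axisX_add_two τ δ (n + 1) w
    have h1 := axisX_add_two τ δ n w
    set a0 := axisX τ δ n w
    set a1 := axisX τ δ (n + 1) w
    simp only [show n + 1 + 3 = n + 4 by ring, show n + 1 + 2 = n + 3 by ring,
      show n + 1 + 1 = n + 2 by ring] at *
    rw [h3, h2, h1]; ring

/-- Otherwise `spiral_turn` keeps all increments of the abscissa positive and the orbit never leaves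
x ≥ 0. -/
theorem IsExit.turn_pos (hδ : 0 < δ) {w : ℝ} (hw : 0 ≤ w) {N : ℕ} (h : IsExit τ δ w N) :
    0 < δ * (w + 1) ^ 2 - τ * w * (w + 1) + w ^ 2 := by
  by_contra! hq
  have hs : ∀ n, 0 < axisX τ δ (n + 1) w - axisX τ δ n w ∧
      0 < axisX τ δ (n + 2) w - axisX τ δ (n + 1) w := by
    intro n
    induction n with
    | zero =>
      refine ⟨by simp only [zero_add, axisX_zero, axisX_one]; linarith, ?_⟩
      simp only [axisX_add_two, zero_add, axisX_zero, axisX_one]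
      have h2 : 0 < δ * (w + 1) ^ 2 := by positivity
      have h1 : 0 < τ * (w + 1) - w := by
        by_contra! hh
        have h3 : 0 ≤ (w + 1) * w := by positivity
        nlinarith
      linarith
    | succ n ih =>
      refine ⟨ih.2, ?_⟩
      have e := spiral_turn (τ := τ) (δ := δ) n w
      have hp := pow_pos hδ n
      have h1 : (axisX τ δ (n + 1) w - axisX τ δ n w) *
          (axisX τ δ (n + 3) w - axisX τ δ (n + 2) w) > 0 := by
        have : 0 < (axisX τ δ (n + 2) w - axisX τ δ (n + 1) w) ^ 2 := pow_pos ih.2 2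
        nlinarith
      exact (mul_pos_iff_of_pos_left ih.1).1 h1
  have hpos : ∀ n, 0 ≤ axisX τ δ n w := by
    intro n
    induction n with
    | zero => simp [axisX_zero]
    | succ n ih => linarith [(hs n).1]
  exact absurd (hpos N) (not_le.2 h.2)

theorem CrossAt.image {w t v : ℝ} {m : ℕ} (h : CrossAt τ δ w m t v) :
    v + 1 = (1 - t) * axisX τ δ (m + 2) w + t * axisX τ δ (m + 3) w := by
  obtain ⟨-, -, h1, h2⟩ := h
  have e1 := axisX_add_two τ δ m w
  have e2 : axisX τ δ (m + 3) w = _ := axisX_add_two τ δ (m + 1) w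
  linear_combination h2 - (1 - t) * e1 - t * e2 - τ * h1

theorem chord_nonneg_of_cross (hδ : 0 < δ) {w t v : ℝ} (hw : 0 ≤ w) {m N : ℕ}
    (hE : IsExit τ δ w N) (h : CrossAt τ δ w m t v) :
    0 ≤ chord v (axisX τ δ (m + 2) w, -δ * axisX τ δ (m + 1) w) := by
  have hi := h.image
  obtain ⟨h0, h1, h2, h3⟩ := h
  have hq := hE.turn_pos hδ hw
  have ht := spiral_turn (τ := τ) (δ := δ) m w
  have key : chord v (axisX τ δ (m + 2) w, -δ * axisX τ δ (m + 1) w) =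
      t * (1 - t) * δ * (δ ^ m * (δ * (w + 1) ^ 2 - τ * w * (w + 1) + w ^ 2)) := by
    rw [← ht, chord]
    set a0 := axisX τ δ m w
    set a1 := axisX τ δ (m + 1) w
    set a2 := axisX τ δ (m + 2) w
    set a3 := axisX τ δ (m + 3) w
    have e1 : v = ((1 - t) * a2 + t * a3) - 1 := by linarith
    have f1 : a2 = (1 - t) * (a2 - a1) := by linear_combination h2
    have f2 : -δ * a1 - v = -(1 - t) * δ * (a1 - a0) := by rw [h3]; ring
    have g1 : v + 1 = (1 - t) * (a2 - a1) + t * (a3 - a2) := by linear_combination hi + h2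
    have g2 : -v = -δ * ((1 - t) * (a1 - a0) + t * (a2 - a1)) := by
      linear_combination (-1 : ℝ) * h3 + δ * h2
    linear_combination (v + 1) * f2 + (-(1 - t) * δ * (a1 - a0)) * g1 + v * f1 -
      ((1 - t) * (a2 - a1)) * g2
  rw [key]
  have := pow_pos hδ m
  have : 0 ≤ 1 - t := by linarith
  positivity

/-- Compares the exit point of w with the chord at the contact ordinate of d; by the Wronskian the
value is -(d-w)δ^{m+1}d. -/
theorem chord_nonpos_of_axis {d w : ℝ} (hδ : 0 < δ) {m : ℕ} (hw : 0 ≤ w) (hwd : w ≤ d)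
    (h : axisX τ δ (m + 1) d = 0) :
    chord (-δ * axisX τ δ m d) (axisX τ δ (m + 2) w, -δ * axisX τ δ (m + 1) w) ≤ 0 := by
  have s1 := axisX_sub τ δ (m + 1) d w
  have s2 := axisX_sub τ δ (m + 2) d w
  have e := axisX_add_two τ δ m d
  have d1 := axisX_succ_sub τ δ (m + 1) d
  have d0 := axisX_succ_sub τ δ m d
  have W := coefB_wronskian τ δ m
  have key : chord (-δ * axisX τ δ m d) (axisX τ δ (m + 2) w, -δ * axisX τ δ (m + 1) w) =
      -((d - w) * (δ * δ ^ m) * d) := by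
    rw [← W, chord]
    rw [h] at s1 e d1 d0
    have e' : -δ * axisX τ δ m d + 1 = axisX τ δ (m + 2) d := by rw [e]; ring
    simp only [e']
    have d2 : -δ * axisX τ δ m d = δ * (coefB τ δ (m + 1) * (d + 1) - coefB τ δ m * d) := by
      linear_combination δ * d0
    have d3 : axisX τ δ (m + 2) d = coefB τ δ (m + 2) * (d + 1) - coefB τ δ (m + 1) * d := by
      linear_combination d1
    rw [s1, s2]
    linear_combination (w - d) * (-δ * coefB τ δ (m + 1)) * d3 +
      (w - d) * coefB τ δ (m + 2) * d2
  rw [key]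
  have := pow_pos hδ m
  have : 0 ≤ (d - w) * (δ * δ ^ m) * d :=
    mul_nonneg (mul_nonneg (by linarith) (by positivity)) (by linarith)
  linarith

/-- Chords are nested in the third quadrant: both intercepts c and c + 1 move away from the origin
as c decreases. -/
theorem chord_neg_of_nonpos {c v : ℝ} (hcv : c < v) (hv : v < -1) {Z : ℝ × ℝ} (h1 : Z.1 < 0)
    (h2 : Z.2 ≤ 0) (h : chord v Z ≤ 0) : chord c Z < 0 := by
  obtain ⟨x, y⟩ := Z
  simp only [chord] at *
  have a1 : 0 ≤ (-y) * ((v - c) * ((v + 1) * (c + 1))) :=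
    mul_nonneg (by linarith) (mul_nonneg (by linarith) (by nlinarith))
  have a2 : 0 < (-x) * ((v - c) * (v * c)) :=
    mul_pos (by linarith) (mul_pos (by linarith) (by nlinarith))
  have a3 : 0 < c * (c + 1) := by nlinarith
  have a4 : 0 < v * (v + 1) := by nlinarith
  by_contra! hc
  have := mul_nonneg hc a4.le
  have := mul_nonneg (neg_nonneg.2 h) a3.le
  nlinarith

theorem chord_pos_of_nonneg {c v : ℝ} (hcv : v < c) (hc : c ≤ -1) {Z : ℝ × ℝ} (h1 : Z.1 < 0)
    (h2 : Z.2 ≤ 0) (h : 0 ≤ chord v Z) : 0 < chord c Z := by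
  rcases hc.eq_or_lt with rfl | hc
  · simp only [chord]; linarith
  by_contra! hn
  exact absurd (chord_neg_of_nonpos hcv hc h1 h2 hn) (not_lt.2 h)

theorem IsExit.inside (hδ : 0 < δ) {w w' : ℝ} (hw : 0 ≤ w) {m m' : ℕ}
    (h : IsExit τ δ w (m + 2)) (hww : w ≤ w') (h' : IsExit τ δ w' (m' + 2)) {c t t' v v' : ℝ}
    (hc : CrossAt τ δ w m t v) (hc' : CrossAt τ δ w' m' t' v') (hc1 : c ≤ -1) (hcv : c < v')
    (hX : chord c (axisX τ δ (m' + 2) w', -δ * axisX τ δ (m' + 1) w') < 0) :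
    c < v ∧ chord c (axisX τ δ (m + 2) w, -δ * axisX τ δ (m + 1) w) < 0 := by
  refine ⟨hcv.trans_le (h.cross_le hδ hw hww h' hc hc'), ?_⟩
  have hB2 := h.coefB_nonpos hw
  have hX2 : -δ * axisX τ δ (m + 1) w ≤ 0 := by nlinarith [h.1 (m + 1) (by omega)]
  obtain ⟨k, hk⟩ := Nat.exists_eq_add_of_le (h.index_le hw hww h')
  obtain ⟨d, h1, h2, h3, ⟨rfl, rfl⟩ | ⟨h4, h5⟩⟩ :=
    h.exists_transition hδ hw k (m' := m') (by omega) hww h'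
  · have s1 := axisX_sub τ δ (m' + 1) w d
    have s2 := axisX_sub τ δ (m' + 2) w d
    rcases le_or_gt 0 (coefB τ δ (m' + 1)) with hB | hB
    · have a1 : 0 ≤ (d - w) * (-(c + 1) * (δ * coefB τ δ (m' + 1))) :=
        mul_nonneg (by linarith) (mul_nonneg (by linarith) (by positivity))
      have a2 : 0 ≤ (d - w) * (c * coefB τ δ (m' + 2)) :=
        mul_nonneg (by linarith) (mul_nonneg_of_nonpos_of_nonpos (by linarith) hB2)
      simp only [chord, s1, s2] at hX ⊢
      nlinarith
    -- The abscissa before exit now decreases with w, so it vanishes at some e ≥ d. Either the chord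
    -- at the contact of e lies inside the chord at c, or the affine function w ↦ chord c is
    -- nonnegative at e and negative at d, hence increasing and negative at w.
    · have ha := h'.1 (m' + 1) (by omega)
      obtain ⟨e, he, he0⟩ : ∃ e, d ≤ e ∧ axisX τ δ (m' + 1) e = 0 := by
        refine ⟨d + axisX τ δ (m' + 1) d / (-coefB τ δ (m' + 1)), ?_, ?_⟩
        · have : 0 ≤ axisX τ δ (m' + 1) d / (-coefB τ δ (m' + 1)) :=
            div_nonneg ha (by linarith)
          linarith
        · rw [axisX_sub τ δ _ d]
          have : coefB τ δ (m' + 1) ≠ 0 := hB.ne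
          field_simp; ring
      have r := axisX_add_two τ δ m' e
      rw [he0] at r
      have he2 := h'.mono (hw.trans hww) he
      rcases lt_or_ge c (-δ * axisX τ δ m' e) with hv | hv
      · exact chord_neg_of_nonpos hv (by linarith) h.2 hX2
          (chord_nonpos_of_axis hδ hw (h1.trans he) he0)
      · set g := -(c + 1) * (δ * coefB τ δ (m' + 1)) + c * coefB τ δ (m' + 2) with hg
        have t1 := axisX_sub τ δ (m' + 1) d e
        have t2 := axisX_sub τ δ (m' + 2) d e
        have E : 0 ≤ chord c (axisX τ δ (m' + 2) e, -δ * axisX τ δ (m' + 1) e) := by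
          simp only [chord, he0]
          nlinarith
        have E1 : chord c (axisX τ δ (m' + 2) e, -δ * axisX τ δ (m' + 1) e) =
            chord c (axisX τ δ (m' + 2) d, -δ * axisX τ δ (m' + 1) d) + (e - d) * g := by
          simp only [chord, t1, t2, hg]; ring
        have E2 : chord c (axisX τ δ (m' + 2) d, -δ * axisX τ δ (m' + 1) d) =
            chord c (axisX τ δ (m' + 2) w, -δ * axisX τ δ (m' + 1) w) + (d - w) * g := by
          simp only [chord, s1, s2, hg]; ring
        have hgp : 0 < g := by
          by_contra! hg0
          nlinarith
        nlinarith
  · have r := axisX_add_two τ δ m d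
    rw [h4] at r
    have := h3.2
    exact chord_neg_of_nonpos (hcv.trans_le (h5 _ _ hc')) (by linarith) h.2 hX2
      (chord_nonpos_of_axis hδ hw h1 h4)

end spiral
-- Exit of the points of a chord
theorem lin_iterate_strip (τ δ : ℝ) (j : ℕ) (w t : ℝ) :
    ((lin τ δ)^[j] (t * (w + 1), (1 - t) * w)).1 =
      (1 - t) * axisX τ δ j w + t * axisX τ δ (j + 1) w := by
  rw [(lin_iterate_fst τ δ j _ _).1]
  simp only [axisX, coefK_succ]; ring

/-- Where the orbit of a point of the segment from `(0, w)` to `(w + 1, 0)` leaves `x ≥ 0`. -/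
theorem IsExit.exit_point {τ δ : ℝ} (hδ : 0 < δ) {w t : ℝ} (hw : 0 ≤ w) (ht : 0 < t)
    (ht1 : t ≤ 1) {m : ℕ} (h : IsExit τ δ w (m + 2)) {s v c₁ c₂ : ℝ}
    (hc : CrossAt τ δ w m s v) (hs : s < 1) (h1 : c₁ < v) (h2 : v < c₂) (h3 : c₂ ≤ -1)
    (hX : chord c₁ (axisX τ δ (m + 2) w, -δ * axisX τ δ (m + 1) w) < 0) :
    ∃ r, (∀ j < r, 0 < ((lin τ δ)^[j] (t * (w + 1), (1 - t) * w)).1) ∧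
      0 ≤ ((lin τ δ)^[r] (t * (w + 1), (1 - t) * w)).1 ∧
      ((lin τ δ)^[r + 1] (t * (w + 1), (1 - t) * w)).1 < 0 ∧
      chord c₁ ((lin τ δ)^[r + 1] (t * (w + 1), (1 - t) * w)) < 0 ∧
      0 < chord c₂ ((lin τ δ)^[r + 1] (t * (w + 1), (1 - t) * w)) := by
  have hX2 : 0 < chord c₂ (axisX τ δ (m + 2) w, -δ * axisX τ δ (m + 1) w) :=
    chord_pos_of_nonneg h2 h3 h.2 (by nlinarith [h.1 (m + 1) (by omega)])
      (chord_nonneg_of_cross hδ hw h hc)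
  have hi := hc.image
  obtain ⟨hs0, -, e1, e2⟩ := hc
  have a1 := h.1 (m + 1) (by omega)
  have a2 := h.2
  have hnn : ∀ j < m + 1, 0 ≤ (1 - t) * axisX τ δ j w + t * axisX τ δ (j + 1) w := fun j hj =>
    add_nonneg (mul_nonneg (by linarith) (h.1 _ (by omega)))
      (mul_nonneg ht.le (h.1 _ (by omega)))
  have hpos : ∀ j < m + 1, (1 - t) * axisX τ δ j w + t * axisX τ δ (j + 1) w = 0 →
      j = m ∧ axisX τ δ (m + 1) w = 0 := by
    intro j hj h0
    have b0 := mul_nonneg (by linarith : 0 ≤ 1 - t) (h.1 j (by omega))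
    have b1 := mul_nonneg ht.le (h.1 (j + 1) (by omega))
    have b2 : axisX τ δ (j + 1) w = 0 := by
      have : t * axisX τ δ (j + 1) w = 0 := by linarith
      exact (mul_eq_zero.1 this).resolve_left ht.ne'
    have := h.touch_last hδ hw b2 (by omega)
    obtain rfl : j = m := by omega
    exact ⟨rfl, b2⟩
  have hsnd : ∀ n, (lin τ δ)^[n + 1] (t * (w + 1), (1 - t) * w) =
      ((1 - t) * axisX τ δ (n + 1) w + t * axisX τ δ (n + 2) w,
        -δ * ((1 - t) * axisX τ δ n w + t * axisX τ δ (n + 1) w)) := by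
    intro n
    rw [← lin_iterate_strip τ δ n, ← lin_iterate_strip τ δ (n + 1), ← lin_iterate_snd]
  simp only [lin_iterate_strip, hsnd]
  rcases lt_or_ge ((1 - t) * axisX τ δ (m + 1) w + t * axisX τ δ (m + 2) w) 0 with hlt | hge
  · refine ⟨m, fun j hj => lt_of_le_of_ne (hnn j (by omega)) fun h0 => ?_, hnn m (by omega), hlt,
      ?_⟩
    · have := (hpos j (by omega) h0.symm).1
      omega
    have hst : s < t := by
      by_contra! hts
      nlinarith
    -- For s < t the exit point is on the segment from (0,v) to X, and `chord c` is interpolated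
    -- between its ends.
    have comb : ∀ c, (1 - s) * chord c ((1 - t) * axisX τ δ (m + 1) w + t * axisX τ δ (m + 2) w,
        -δ * ((1 - t) * axisX τ δ m w + t * axisX τ δ (m + 1) w)) =
        (1 - t) * ((c + 1) * (v - c)) +
          (t - s) * chord c (axisX τ δ (m + 2) w, -δ * axisX τ δ (m + 1) w) := by
      intro c
      simp only [chord]
      linear_combination c * (1 - t) * e1 - (c + 1) * (1 - t) * e2
    have c1 := comb c₁
    have c2 := comb c₂
    constructor
    · have : (t - s) * chord c₁ (axisX τ δ (m + 2) w, -δ * axisX τ δ (m + 1) w) < 0 :=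
        mul_neg_of_pos_of_neg (by linarith) hX
      have : (1 - t) * ((c₁ + 1) * (v - c₁)) ≤ 0 :=
        mul_nonpos_of_nonneg_of_nonpos (by linarith)
          (mul_nonpos_of_nonpos_of_nonneg (by linarith) (by linarith))
      by_contra! hn
      nlinarith
    · have : 0 < (t - s) * chord c₂ (axisX τ δ (m + 2) w, -δ * axisX τ δ (m + 1) w) :=
        mul_pos (by linarith) hX2
      have : 0 ≤ (1 - t) * ((c₂ + 1) * (v - c₂)) :=
        mul_nonneg (by linarith) (mul_nonneg_of_nonpos_of_nonpos (by linarith) (by linarith))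
      by_contra! hn
      nlinarith
  · have hts : t ≤ s := by
      by_contra! hst
      nlinarith
    have hs' : 0 < s := ht.trans_le hts
    -- For t ≤ s the exit is one step later, on the segment from X to (v+1,0).
    have comb : ∀ c, s * chord c ((1 - t) * axisX τ δ (m + 2) w + t * axisX τ δ (m + 3) w,
        -δ * ((1 - t) * axisX τ δ (m + 1) w + t * axisX τ δ (m + 2) w)) =
        t * (c * (v - c)) +
          (s - t) * chord c (axisX τ δ (m + 2) w, -δ * axisX τ δ (m + 1) w) := by
      intro c
      simp only [chord]
      linear_combination (-c * t) * hi - (c + 1) * δ * t * e1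
    refine ⟨m + 1, fun j hj => lt_of_le_of_ne (hnn j hj) fun h0 => ?_, hge, ?_, ?_, ?_⟩
    · have := (hpos j hj h0.symm).2
      rw [this] at hge
      nlinarith
    · have : s * ((1 - t) * axisX τ δ (m + 2) w + t * axisX τ δ (m + 3) w) =
        (s - t) * axisX τ δ (m + 2) w + t * (v + 1) := by rw [hi]; ring
      have h5 : (s - t) * axisX τ δ (m + 2) w ≤ 0 :=
        mul_nonpos_of_nonneg_of_nonpos (by linarith) a2.le
      have h6 : t * (v + 1) < 0 := mul_neg_of_pos_of_neg ht (by linarith)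
      by_contra! hn
      have := mul_nonneg hs'.le hn
      linarith
    · have c1 := comb c₁
      have : (s - t) * chord c₁ (axisX τ δ (m + 2) w, -δ * axisX τ δ (m + 1) w) ≤ 0 :=
        mul_nonpos_of_nonneg_of_nonpos (by linarith) hX.le
      have : t * (c₁ * (v - c₁)) < 0 :=
        mul_neg_of_pos_of_neg ht (mul_neg_of_neg_of_pos (by linarith) (by linarith))
      by_contra! hn
      have := mul_nonneg hs'.le hn
      linarith
    · have c1 := comb c₂
      have : 0 ≤ (s - t) * chord c₂ (axisX τ δ (m + 2) w, -δ * axisX τ δ (m + 1) w) :=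
        mul_nonneg (by linarith) hX2.le
      have : 0 < t * (c₂ * (v - c₂)) :=
        mul_pos ht (mul_pos_of_neg_of_neg (by linarith) (by linarith))
      by_contra! hn
      have := mul_nonpos_of_nonneg_of_nonpos hs'.le hn
      linarith

/-- Points of the first quadrant between two chords lie on a chord in between. -/
theorem exists_strip_coord {X Y w₁ w₂ : ℝ} (hX : 0 < X) (hY : 0 ≤ Y) (h0 : 0 ≤ w₁) (h0' : 0 < w₂)
    (hw : w₁ ≤ w₂) (h₂ : chord w₂ (X, Y) ≤ 0) (h₁ : 0 ≤ chord w₁ (X, Y))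
    (hY0 : Y = 0 → w₁ + 1 ≤ X) :
    ∃ w t, w₁ ≤ w ∧ w ≤ w₂ ∧ 0 < t ∧ t ≤ 1 ∧ X = t * (w + 1) ∧ Y = (1 - t) * w := by
  rcases hY.eq_or_lt with rfl | hY
  · have hX1 := hY0 rfl
    refine ⟨X - 1, 1, by linarith, ?_, one_pos, le_rfl, by ring, by ring⟩
    simp only [chord] at h₂
    nlinarith
  · have hc : ContinuousOn (fun w => chord w (X, Y)) (Icc w₁ w₂) := by
      unfold chord; fun_prop
    obtain ⟨w, hw', e⟩ := intermediate_value_Icc' hw hc ⟨h₂, h₁⟩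
    simp only [chord] at e
    have hw0 : 0 < w := by
      rcases (h0.trans hw'.1).eq_or_lt with h | h
      · rw [← h] at e; linarith
      · exact h
    refine ⟨w, X / (w + 1), hw'.1, hw'.2, by positivity, ?_, by field_simp, ?_⟩
    · rw [div_le_one (by linarith)]
      nlinarith
    · field_simp; linarith

/-! ### Preimages of the switching line under the left half-map -/

section left

variable (τ δ : ℝ)

/-- The `y`-intercept of the `k`-th preimage of the `y`-axis under `lin τ δ`. -/
noncomputable def icept (k : ℕ) : ℝ := -coefK τ δ k / coefB τ δ k

/-- A Casoratian of `coefK` and `coefB`. -/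
def coefG (k : ℕ) : ℝ := coefK τ δ (k + 1) * coefB τ δ k - coefK τ δ k * coefB τ δ (k + 1)

/-- The iterate `k + 1` of `(0, icept (k + 1))` is `(0, level k)`. -/
noncomputable def level (k : ℕ) : ℝ := δ * coefG τ δ k / coefB τ δ (k + 1)

theorem coefG_succ (k : ℕ) : coefG τ δ (k + 1) = δ * coefG τ δ k + coefB τ δ (k + 1) := by
  simp only [coefG]
  have h1 := coefB_add_two τ δ k
  have h2 := coefK_add_two τ δ k
  linear_combination coefB τ δ (k + 1) * h2 - coefK τ δ (k + 1) * h1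

theorem coefG_zero : coefG τ δ 0 = 0 := by simp [coefG, coefK, coefB]

variable {τ δ} {b : ℕ} (hδ : 0 < δ) (hB : ∀ k ≤ b, 0 < coefB τ δ (k + 1))
include hδ hB

theorem coefG_nonneg (k : ℕ) (hk : k ≤ b + 1) : 0 ≤ coefG τ δ k := by
  induction k with
  | zero => rw [coefG_zero]
  | succ k ih =>
    rw [coefG_succ]
    have := hB k (by omega)
    have := ih (by omega)
    positivity

theorem coefG_pos (k : ℕ) (hk : k ≤ b) : 0 < coefG τ δ (k + 1) := by
  rw [coefG_succ]
  have := hB k hk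
  have := coefG_nonneg hδ hB k (by omega)
  positivity

omit hδ in
theorem coefK_pos_left (k : ℕ) (hk : k ≤ b) : 0 < coefK τ δ (k + 1) := by
  induction k with
  | zero => simp [coefK, coefB]
  | succ k ih =>
    rw [coefK_succ]
    have := hB _ hk
    have := ih (by omega)
    positivity

omit hδ in
theorem level_add_one (k : ℕ) (hk : k ≤ b) :
    level τ δ k + 1 = coefG τ δ (k + 1) / coefB τ δ (k + 1) := by
  have := (hB k hk).ne'
  rw [coefG_succ, level]; field_simp

theorem level_nonneg (k : ℕ) (hk : k ≤ b) : 0 ≤ level τ δ k := by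
  have := coefG_nonneg hδ hB k (by omega)
  have := hB k hk
  rw [level]; positivity

theorem level_pos (k : ℕ) (hk : k + 1 ≤ b) : 0 < level τ δ (k + 1) := by
  have := coefG_pos hδ hB k (by omega)
  have := hB _ hk
  rw [level]; positivity

theorem level_lt_succ (k : ℕ) (hk : k + 1 ≤ b) : level τ δ k < level τ δ (k + 1) := by
  have h1 := hB k (by omega)
  have h2 := hB _ hk
  rw [level, level, div_lt_div_iff₀ h1 h2]
  have key : coefG τ δ (k + 1) * coefB τ δ (k + 1) - coefG τ δ k * coefB τ δ (k + 2) =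
      δ ^ k * coefK τ δ (k + 1) := by
    rw [← coefB_wronskian τ δ k]
    simp only [coefG]
    have e1 := coefK_succ τ δ (k + 1)
    have e0 := coefK_succ τ δ k
    rw [e1, e0]
    ring
  have := coefK_pos_left hB k (by omega)
  have : 0 < δ ^ k * coefK τ δ (k + 1) := by positivity
  nlinarith

theorem level_mono (j k : ℕ) (hjk : j ≤ k) (hk : k ≤ b) : level τ δ j ≤ level τ δ k := by
  induction k, hjk using Nat.le_induction with
  | base => rfl
  | succ k hjk ih => exact (ih (by omega)).trans (level_lt_succ hδ hB k hk).le

theorem icept_succ_lt (k : ℕ) (hk : k + 1 ≤ b) : icept τ δ (k + 2) < icept τ δ (k + 1) := by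
  have h1 := hB k (by omega)
  have h2 := hB _ hk
  have := coefG_pos hδ hB k (by omega)
  rw [coefG] at this
  rw [icept, icept, div_lt_div_iff₀ h2 h1]
  linarith

theorem icept_anti (j k : ℕ) (hjk : j ≤ k) (hk : k ≤ b) :
    icept τ δ (k + 1) ≤ icept τ δ (j + 1) := by
  induction k, hjk using Nat.le_induction with
  | base => rfl
  | succ k hjk ih => exact (icept_succ_lt hδ hB k hk).le.trans (ih (by omega))

theorem icept_strictAnti (j k : ℕ) (hjk : j < k) (hk : k ≤ b) :
    icept τ δ (k + 1) < icept τ δ (j + 1) := by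
  obtain _ | k := k
  · omega
  exact (icept_succ_lt hδ hB k hk).trans_le (icept_anti hδ hB j k (by omega) (by omega))

omit hδ hB in
theorem icept_one : icept τ δ 1 = -1 := by simp [icept, coefK, coefB]

theorem icept_le_neg_one (k : ℕ) (hk : k ≤ b) : icept τ δ (k + 1) ≤ -1 := by
  simpa [icept_one] using icept_anti hδ hB 0 k (by omega) hk

theorem icept_lt_neg_one (k : ℕ) (hk : k + 1 ≤ b) : icept τ δ (k + 2) < -1 := by
  simpa [icept_one] using icept_strictAnti hδ hB 0 (k + 1) (by omega) hk

omit hδ in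
theorem axisX_icept (j k : ℕ) (hj : j ≤ b) :
    axisX τ δ (j + 1) (icept τ δ (k + 1)) =
      coefB τ δ (j + 1) * (icept τ δ (k + 1) - icept τ δ (j + 1)) := by
  have := (hB j hj).ne'
  rw [axisX, mul_sub, show coefB τ δ (j + 1) * icept τ δ (j + 1) = -coefK τ δ (j + 1) by
    rw [icept]; field_simp]
  ring

theorem axisX_icept_nonpos (i k : ℕ) (hi : i ≤ k + 1) (hk : k ≤ b) :
    axisX τ δ i (icept τ δ (k + 1)) ≤ 0 := by
  obtain _ | i := i
  · rw [axisX_zero]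
  rw [axisX_icept hB i k (by omega)]
  exact mul_nonpos_of_nonneg_of_nonpos (hB i (by omega)).le
    (by linarith [icept_anti hδ hB i k (by omega) hk])

theorem axisX_icept_neg (i k : ℕ) (hi : i < k) (hk : k ≤ b) :
    axisX τ δ (i + 1) (icept τ δ (k + 1)) < 0 := by
  rw [axisX_icept hB i k (by omega)]
  exact mul_neg_of_pos_of_neg (hB i (by omega))
    (by linarith [icept_strictAnti hδ hB i k (by omega) hk])

theorem lin_iterate_icept (k : ℕ) (hk : k ≤ b) :
    (lin τ δ)^[k + 1] (0, icept τ δ (k + 1)) = (0, level τ δ k) := by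
  have hb := (hB k hk).ne'
  ext
  · rw [lin_iterate_axis, axisX_icept hB k k hk, sub_self, mul_zero]
  · rw [lin_iterate_snd, lin_iterate_axis, axisX, icept, level, coefG]
    field_simp
    ring

/-- Both chords join a point to its image, and the map commutes with its iterates, so one chord goes
to the other; the factor is the determinant. -/
theorem chord_lin_iterate (k : ℕ) (hk : k ≤ b) (Z : ℝ × ℝ) :
    chord (level τ δ k) ((lin τ δ)^[k + 1] Z) = δ ^ (k + 1) * chord (icept τ δ (k + 1)) Z := by
  have h := lin_iterate_det τ δ (k + 1) (0, icept τ δ (k + 1)) (lin τ δ (0, icept τ δ (k + 1))) Z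
  rw [← Function.iterate_succ_apply, Function.iterate_succ_apply', lin_iterate_icept hδ hB k hk]
    at h
  simp only [lin, mul_zero, zero_add, sub_zero] at h
  simp only [chord]
  linear_combination h

/-- The first passage of a point between two chords of the third quadrant into `x > 0`. -/
theorem left_passage {a : ℕ} (hab : a < b) {x y : ℝ} (hx : x < 0) (hy : y ≤ 0)
    (h₁ : chord (icept τ δ (b + 1)) (x, y) ≤ 0) (h₂ : 0 ≤ chord (icept τ δ (a + 1)) (x, y)) :
    ∃ p, (∀ j < p, ((lin τ δ)^[j] (x, y)).1 < 0) ∧ ((lin τ δ)^[p] (x, y)).1 ≤ 0 ∧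
      0 < ((lin τ δ)^[p + 1] (x, y)).1 ∧
      chord (level τ δ b) ((lin τ δ)^[p + 1] (x, y)) ≤ 0 ∧
      0 ≤ chord (level τ δ a) ((lin τ δ)^[p + 1] (x, y)) ∧
      (((lin τ δ)^[p + 1] (x, y)).2 = 0 →
        level τ δ a + 1 ≤ ((lin τ δ)^[p + 1] (x, y)).1) := by
  have hfst : ∀ j, ((lin τ δ)^[j] (x, y)).1 =
    coefB τ δ (j + 1) * x + coefB τ δ j * y + coefK τ δ j := fun j => (lin_iterate_fst τ δ j x y).1
  -- With c the outer intercept, (c+1) times this abscissa equals `coefB` times `chord c` plus x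
  -- times `axisX` at c one step later; the latter is positive, so the sum is negative.
  have hend : 0 < ((lin τ δ)^[b + 1] (x, y)).1 := by
    obtain ⟨b', rfl⟩ : ∃ b', b = b' + 1 := ⟨b - 1, by omega⟩
    have hc := icept_lt_neg_one hδ hB b' le_rfl
    have hbp := (hB _ le_rfl)
    have hg : 0 < axisX τ δ (b' + 1 + 2) (icept τ δ (b' + 2)) := by
      have := coefG_pos hδ hB _ le_rfl
      rw [coefG] at this
      have e : axisX τ δ (b' + 1 + 2) (icept τ δ (b' + 2)) * coefB τ δ (b' + 2) =
        coefK τ δ (b' + 3) * coefB τ δ (b' + 2) - coefK τ δ (b' + 2) * coefB τ δ (b' + 3) := by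
        rw [axisX, icept]
        have := hbp.ne'
        field_simp
        ring
      exact pos_of_mul_pos_left (e ▸ this) hbp.le
    have hK : coefK τ δ (b' + 2) = -icept τ δ (b' + 2) * coefB τ δ (b' + 2) := by
      rw [icept]
      have := hbp.ne'
      field_simp
    rw [hfst]
    rw [axisX, coefK_succ] at hg
    simp only [chord] at h₁
    simp only [show b' + 1 + 1 = b' + 2 by ring, show b' + 1 + 2 = b' + 3 by ring] at *
    rw [hK] at hg ⊢
    set c := icept τ δ (b' + 2)
    have h5 := mul_neg_of_neg_of_pos hx hg
    have h6 := mul_nonpos_of_nonneg_of_nonpos hbp.le h₁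
    by_contra! hn
    have := mul_nonneg_of_nonpos_of_nonpos (by linarith : c + 1 ≤ 0) hn
    nlinarith
  have hstart : ∀ i ≤ a, ((lin τ δ)^[i] (x, y)).1 ≤ 0 := by
    intro i hi
    obtain _ | i := i
    · exact hx.le
    obtain ⟨a', rfl⟩ : ∃ a', a = a' + 1 := ⟨a - 1, by omega⟩
    have hc := icept_lt_neg_one hδ hB a' (by omega)
    have u1 := axisX_icept_nonpos hδ hB (i + 1) (a' + 1) (by omega) (by omega)
    have u2 := axisX_icept_nonpos hδ hB (i + 1 + 1) (a' + 1) (by omega) (by omega)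
    have hK := coefK_pos_left hB i (by omega)
    rw [hfst]
    rw [axisX] at u1 u2
    rw [coefK_succ] at u2
    simp only [show a' + 1 + 1 = a' + 2 by ring, chord] at *
    set c := icept τ δ (a' + 2)
    have v1 := mul_nonneg (mul_nonneg_of_nonpos_of_nonpos hx.le (by linarith : c ≤ 0))
      (neg_nonneg.2 u2)
    have v2 := mul_nonneg (mul_nonneg_of_nonpos_of_nonpos hy (by linarith : c + 1 ≤ 0))
      (neg_nonneg.2 u1)
    have v3 := mul_nonneg hK.le h₂
    have hcc : 0 < c * (c + 1) := mul_pos_of_neg_of_neg (by linarith) (by linarith)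
    by_contra! hn
    have := mul_pos hcc hn
    nlinarith
  classical
  have hex : ∃ n, 0 < ((lin τ δ)^[n] (x, y)).1 := ⟨_, hend⟩
  obtain ⟨p, hp⟩ : ∃ p, Nat.find hex = p + 1 := by
    refine Nat.exists_eq_succ_of_ne_zero fun h0 => ?_
    have := Nat.find_spec hex
    rw [h0] at this
    exact absurd this (not_lt.2 hx.le)
  have hpos := Nat.find_spec hex
  rw [hp] at hpos
  have hmin : ∀ j ≤ p, ((lin τ δ)^[j] (x, y)).1 ≤ 0 := fun j hj =>
    not_lt.1 (Nat.find_min hex (by omega))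
  have hpb : p ≤ b := by
    by_contra! hlt
    exact absurd (hmin _ (Nat.succ_le_of_lt hlt)) (not_le.2 hend)
  have hap : a ≤ p := by
    by_contra! hlt
    exact absurd (hstart _ (Nat.succ_le_of_lt hlt)) (not_le.2 hpos)
  have hY : 0 ≤ ((lin τ δ)^[p + 1] (x, y)).2 := by
    rw [lin_iterate_snd]; nlinarith [hmin p le_rfl]
  have hYe : ((lin τ δ)^[p + 1] (x, y)).2 =
      -δ * (coefB τ δ (p + 1) * x + coefB τ δ p * y + coefK τ δ p) := by
    rw [lin_iterate_snd, hfst]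
  have hW := coefB_wronskian τ δ p
  have hδp := pow_pos hδ p
  have hla := level_nonneg hδ hB a hab.le
  -- Image of x < 0 under the iterate p + 1: the y-axis goes to the line through (0, level p) and
  -- (level (p-1) + 1, 0).
  have inner : a < p → 0 < level τ δ p ∧ ∃ u, level τ δ a ≤ u ∧ u ≤ level τ δ p ∧
      level τ δ p * (u + 1) ≤ level τ δ p * ((lin τ δ)^[p + 1] (x, y)).1 +
        (u + 1) * ((lin τ δ)^[p + 1] (x, y)).2 := by
    intro h
    obtain ⟨r, rfl⟩ : ∃ r, p = r + 1 := ⟨p - 1, by omega⟩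
    refine ⟨level_pos hδ hB r hpb, level τ δ r, level_mono hδ hB a r (by omega) (by omega),
      (level_lt_succ hδ hB r hpb).le, ?_⟩
    have b1 := hB r (by omega)
    have b2 := hB _ hpb
    have g := coefG_pos hδ hB r (by omega)
    have key : δ * coefB τ δ (r + 1) * ((lin τ δ)^[r + 1 + 1] (x, y)).1 +
        coefB τ δ (r + 2) * ((lin τ δ)^[r + 1 + 1] (x, y)).2 =
        δ * (-δ ^ (r + 1) * x + coefG τ δ (r + 1)) := by
      rw [hYe, hfst, ← hW, coefG]
      have := coefK_succ τ δ (r + 1)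
      simp only [show r + 1 + 1 = r + 2 by ring, show r + 2 + 1 = r + 3 by ring] at *
      rw [this]
      ring
    rw [level_add_one hB r (by omega), level]
    have : 0 ≤ δ * (-δ ^ (r + 1) * x) := by
      have := mul_nonneg (mul_nonneg hδ.le hδp.le) (neg_nonneg.2 hx.le)
      linarith
    have h6 : δ * coefG τ δ (r + 1) ≤ δ * coefB τ δ (r + 1) *
        ((lin τ δ)^[r + 1 + 1] (x, y)).1 + coefB τ δ (r + 2) *
          ((lin τ δ)^[r + 1 + 1] (x, y)).2 := by rw [key]; linarith
    have e1 : δ * coefG τ δ (r + 1) / coefB τ δ (r + 1 + 1) *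
        (coefG τ δ (r + 1) / coefB τ δ (r + 1)) =
        (coefG τ δ (r + 1) / (coefB τ δ (r + 1) * coefB τ δ (r + 2))) *
          (δ * coefG τ δ (r + 1)) := by
      field_simp
    have e2 : ∀ X Y : ℝ, δ * coefG τ δ (r + 1) / coefB τ δ (r + 1 + 1) * X +
        (coefG τ δ (r + 1) / coefB τ δ (r + 1)) * Y =
        (coefG τ δ (r + 1) / (coefB τ δ (r + 1) * coefB τ δ (r + 2))) *
          (δ * coefB τ δ (r + 1) * X + coefB τ δ (r + 2) * Y) := by
      intro X Y
      field_simp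
    rw [e1, e2]
    exact mul_le_mul_of_nonneg_left h6 (by positivity)
  -- Likewise y ≤ 0: the x-axis goes to the line through (0, level (p+1)) and (level p + 1, 0).
  have outer : p < b → 0 < level τ δ (p + 1) ∧
      level τ δ (p + 1) * ((lin τ δ)^[p + 1] (x, y)).1 +
        (level τ δ p + 1) * ((lin τ δ)^[p + 1] (x, y)).2 ≤
      level τ δ (p + 1) * (level τ δ p + 1) := by
    intro h
    refine ⟨level_pos hδ hB p h, ?_⟩
    have b1 := hB p (by omega)
    have b2 := hB _ h
    have g := coefG_pos hδ hB p (by omega)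
    have key : δ * coefB τ δ (p + 1) * ((lin τ δ)^[p + 1] (x, y)).1 +
        coefB τ δ (p + 2) * ((lin τ δ)^[p + 1] (x, y)).2 =
        δ * (δ ^ p * y + coefG τ δ (p + 1)) := by
      rw [hYe, hfst, ← hW, coefG]
      have f2 := coefK_succ τ δ (p + 1)
      have f1 := coefK_succ τ δ p
      ring_nf at f1 f2 ⊢
      linear_combination (-δ * coefB τ δ (1 + p)) * f2 + δ * coefB τ δ (2 + p) * f1
    rw [level_add_one hB p (by omega), level]
    have : δ * (δ ^ p * y) ≤ 0 :=
      mul_nonpos_of_nonneg_of_nonpos hδ.le (mul_nonpos_of_nonneg_of_nonpos hδp.le hy)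
    have h6 : δ * coefB τ δ (p + 1) * ((lin τ δ)^[p + 1] (x, y)).1 +
        coefB τ δ (p + 2) * ((lin τ δ)^[p + 1] (x, y)).2 ≤ δ * coefG τ δ (p + 1) := by
      rw [key]; linarith
    have e1 : δ * coefG τ δ (p + 1) / coefB τ δ (p + 1 + 1) *
        (coefG τ δ (p + 1) / coefB τ δ (p + 1)) =
        (coefG τ δ (p + 1) / (coefB τ δ (p + 1) * coefB τ δ (p + 2))) *
          (δ * coefG τ δ (p + 1)) := by
      field_simp
    have e2 : ∀ X Y : ℝ, δ * coefG τ δ (p + 1) / coefB τ δ (p + 1 + 1) * X +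
        (coefG τ δ (p + 1) / coefB τ δ (p + 1)) * Y =
        (coefG τ δ (p + 1) / (coefB τ δ (p + 1) * coefB τ δ (p + 2))) *
          (δ * coefB τ δ (p + 1) * X + coefB τ δ (p + 2) * Y) := by
      intro X Y
      field_simp
    rw [e1, e2]
    exact mul_le_mul_of_nonneg_left h6 (by positivity)
  have hin : 0 ≤ chord (level τ δ a) ((lin τ δ)^[p + 1] (x, y)) := by
    rcases hap.eq_or_lt with rfl | h
    · rw [chord_lin_iterate hδ hB a hpb]
      exact mul_nonneg (by positivity) h₂
    · obtain ⟨h0, u, hu1, hu2, hu⟩ := inner h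
      rw [chord]
      set X := ((lin τ δ)^[p + 1] (x, y)).1
      set Y := ((lin τ δ)^[p + 1] (x, y)).2
      set α := level τ δ a
      set β := level τ δ p
      have v1 := mul_le_mul_of_nonneg_left hu (by positivity : 0 ≤ α * (α + 1))
      have v2 : 0 ≤ (u - α) * (β * α * X) := mul_nonneg (by linarith) (by positivity)
      have v3 : 0 ≤ (β - α) * ((u + 1) * (α + 1) * Y) :=
        mul_nonneg (by linarith) (mul_nonneg (mul_nonneg (by linarith) (by linarith)) hY)
      have hk : 0 < β * (u + 1) := mul_pos h0 (by linarith)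
      by_contra! hn
      nlinarith
  refine ⟨p, fun j hj => lt_of_le_of_ne (hmin j hj.le) fun h0 => ?_, hmin p le_rfl, hpos, ?_,
    hin, ?_⟩
  · obtain _ | j := j
    · exact hx.ne h0
    have h1 := hmin _ (Nat.succ_le_of_lt hj)
    have e : ((lin τ δ)^[j + 1 + 1] (x, y)).1 = τ * ((lin τ δ)^[j + 1] (x, y)).1 +
        -δ * ((lin τ δ)^[j] (x, y)).1 + 1 := by
      rw [Function.iterate_succ_apply', lin, lin_iterate_snd]
    rw [h0] at e
    have := hmin j (by omega)
    simp only [Nat.succ_eq_add_one] at h1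
    nlinarith
  · rcases hpb.eq_or_lt with rfl | h
    · rw [chord_lin_iterate hδ hB p le_rfl]
      exact mul_nonpos_of_nonneg_of_nonpos (by positivity) h₁
    · obtain ⟨h0, hu⟩ := outer h
      have h1 := level_mono hδ hB p b hpb le_rfl
      have h2 := level_mono hδ hB (p + 1) b h le_rfl
      have h3 := level_nonneg hδ hB p hpb
      rw [chord]
      set X := ((lin τ δ)^[p + 1] (x, y)).1
      set Y := ((lin τ δ)^[p + 1] (x, y)).2
      set α := level τ δ p
      set β := level τ δ (p + 1)
      set w := level τ δ b
      have hw : 0 < w := h0.trans_le h2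
      have v1 := mul_le_mul_of_nonneg_left hu (by positivity : 0 ≤ w * (w + 1))
      have v2 : 0 ≤ (w - α) * (β * w * X) := mul_nonneg (by linarith) (by positivity)
      have v3 : 0 ≤ (w - β) * ((α + 1) * (w + 1) * Y) :=
        mul_nonneg (by linarith) (by positivity)
      have hk : 0 < β * (α + 1) := mul_pos h0 (by linarith)
      by_contra! hn
      nlinarith
  -- Needed because level 0 = 0: that chord is the x-axis itself and does not bound X from below
  -- when Y = 0.
  · intro h0
    rcases hap.eq_or_lt with rfl | h
    · obtain _ | a := a
      · rw [hYe] at h0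
        simp only [coefB, coefK] at h0
        nlinarith
      · have := level_pos hδ hB a hpb
        rw [chord, h0] at hin
        nlinarith
    · obtain ⟨h0', u, hu1, hu2, hu⟩ := inner h
      rw [h0] at hu
      have : u + 1 ≤ ((lin τ δ)^[p + 1] (x, y)).1 := by nlinarith
      linarith

end left
/-! ### Orbits of the piecewise map -/

section orbits

variable (P : BCNF)

theorem fL_eq_lin : P.fL = lin P.τL P.δL := rfl

theorem fR_eq_lin : P.fR = lin P.τR P.δR := rfl

theorem lineK_eq (i : ℕ) : P.lineK i = coefK P.τL P.δL i := by
  rw [lineK, fL_eq_lin, (lin_iterate_fst _ _ i _ _).1]; ring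

theorem lineA_eq (i : ℕ) : P.lineA i = coefB P.τL P.δL (i + 1) := by
  rw [lineA, fL_eq_lin, (lin_iterate_fst _ _ i _ _).1, (lin_iterate_fst _ _ i _ _).1]; ring

theorem lineB_eq (i : ℕ) : P.lineB i = coefB P.τL P.δL i := by
  rw [lineB, fL_eq_lin, (lin_iterate_fst _ _ i _ _).1, (lin_iterate_fst _ _ i _ _).1]; ring

theorem intercept_eq (i : ℕ) : P.intercept i = icept P.τL P.δL i := by
  rw [intercept, lineK_eq, lineB_eq, icept]

/-- The slope m_k is -B_{k+1}/B_k, so the first nonpositive B would give a nonnegative slope one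
index earlier. -/
theorem coefB_pos_of_le_pStar {b : ℕ} (hb : ((b + 1 : ℕ) : ℕ∞) ≤ P.pStar) :
    ∀ k ≤ b, 0 < coefB P.τL P.δL (k + 1) := by
  intro k
  induction k with
  | zero => intro _; simp [coefB]
  | succ k ih =>
    intro hk
    have h0 := ih (by omega)
    by_contra! hn
    have hmem : ((k + 1 : ℕ) : ℕ∞) ∈
        {i : ℕ∞ | ∃ k : ℕ, i = k ∧ 1 ≤ k ∧ P.lineB k ≠ 0 ∧ 0 ≤ P.slope k} := by
      refine ⟨k + 1, rfl, by omega, ?_, ?_⟩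
      · rw [lineB_eq]; exact h0.ne'
      · rw [slope, lineA_eq, lineB_eq]
        exact div_nonneg (by linarith) h0.le
    have h1 : ((b + 1 : ℕ) : ℕ∞) ≤ ((k + 1 : ℕ) : ℕ∞) := hb.trans (sInf_le hmem)
    have : b + 1 ≤ k + 1 := by exact_mod_cast h1
    omega

variable {P}

theorem f_of_nonpos {Z : ℝ × ℝ} (h : Z.1 ≤ 0) : P.f Z = P.fL Z := if_pos h

theorem f_of_nonneg {Z : ℝ × ℝ} (h : 0 ≤ Z.1) : P.f Z = P.fR Z := by
  rcases h.eq_or_lt with h | h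
  · rw [f_of_nonpos h.ge]
    simp [fL, fR, ← h]
  · exact if_neg (not_le.2 h)

theorem f_axis (y : ℝ) : P.f (0, y) = (y + 1, 0) := by
  rw [f_of_nonpos le_rfl]; simp [fL]

theorem continuous_f : Continuous P.f := by
  unfold f
  refine Continuous.if_le ?_ ?_ continuous_fst continuous_const ?_
  · unfold fL; fun_prop
  · unfold fR; fun_prop
  · intro Z hZ
    simp [fL, fR, hZ]

theorem iterate_f_left {Z : ℝ × ℝ} {n : ℕ}
    (h : ∀ j < n, ((lin P.τL P.δL)^[j] Z).1 ≤ 0) : P.f^[n] Z = (lin P.τL P.δL)^[n] Z := by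
  induction n with
  | zero => rfl
  | succ n ih =>
    rw [Function.iterate_succ_apply', Function.iterate_succ_apply', ih fun j hj => h j (by omega),
      f_of_nonpos (h n (by omega)), fL_eq_lin]

theorem iterate_f_right {Z : ℝ × ℝ} {n : ℕ}
    (h : ∀ j < n, 0 ≤ ((lin P.τR P.δR)^[j] Z).1) : P.f^[n] Z = (lin P.τR P.δR)^[n] Z := by
  induction n with
  | zero => rfl
  | succ n ih =>
    rw [Function.iterate_succ_apply', Function.iterate_succ_apply', ih fun j hj => h j (by omega),
      f_of_nonneg (h n (by omega)), fR_eq_lin]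

theorem iterate_f_snd_pos (hδL : 0 < P.δL) {Z : ℝ × ℝ} {n : ℕ} (h : (P.f^[n] Z).1 < 0) :
    0 < (P.f^[n + 1] Z).2 := by
  rw [Function.iterate_succ_apply', f_of_nonpos h.le, fL]
  nlinarith

theorem iterate_f_snd_nonpos (hδR : 0 < P.δR) {Z : ℝ × ℝ} {n : ℕ} (h : 0 ≤ (P.f^[n] Z).1) :
    (P.f^[n + 1] Z).2 ≤ 0 := by
  rw [Function.iterate_succ_apply', f_of_nonneg h, fR]
  nlinarith

theorem F_eq_iterate {Z : ℝ × ℝ} {n : ℕ} (hn : 1 ≤ n) (h : P.f^[n] Z ∈ Phi)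
    (hmin : ∀ i, 1 ≤ i → i < n → P.f^[i] Z ∉ Phi) : P.F Z = P.f^[n] Z := by
  have : IsLeast {n : ℕ | 1 ≤ n ∧ P.f^[n] Z ∈ Phi} n :=
    ⟨⟨hn, h⟩, fun i hi => not_lt.1 fun hlt => hmin i hi.1 hlt hi.2⟩
  rw [F, returnTime, this.csInf_eq]

/-- `N + 1` is the return time of `Z` to `Phi`, and the orbit avoids the closure of `Phi` at the
positive times before `N`. -/
structure IsReturn (P : BCNF) (Z : ℝ × ℝ) (N : ℕ) : Prop where
  one_le : 1 ≤ N
  avoid : ∀ i, 1 ≤ i → i < N → 0 < (P.f^[i] Z).1 ∨ 0 < (P.f^[i] Z).2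
  fst_nonneg : 0 ≤ (P.f^[N] Z).1
  fst_neg : (P.f^[N + 1] Z).1 < 0
  snd_nonpos : (P.f^[N + 1] Z).2 ≤ 0

theorem IsReturn.notMem {Z : ℝ × ℝ} {N : ℕ} (h : P.IsReturn Z N) (i : ℕ) (h1 : 1 ≤ i)
    (hi : i < N + 1) : P.f^[i] Z ∉ Phi := by
  rintro ⟨hx, hy⟩
  obtain hlt | rfl := Nat.lt_succ_iff_lt_or_eq.1 hi
  · rcases h.avoid i h1 hlt with h2 | h2 <;> linarith
  · exact absurd hx (not_lt.2 h.fst_nonneg)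

theorem IsReturn.F_eq {Z : ℝ × ℝ} {N : ℕ} (h : P.IsReturn Z N) : P.F Z = P.f^[N + 1] Z :=
  F_eq_iterate (by omega) ⟨h.fst_neg, h.snd_nonpos⟩ h.notMem

/-- Makes `F` compatible with the gluing: a point near the axis may be replaced by its image. -/
theorem IsReturn.F_f {Z : ℝ × ℝ} {N : ℕ} (h : P.IsReturn Z N) : P.F (P.f Z) = P.F Z := by
  rw [h.F_eq]
  refine (F_eq_iterate h.one_le ?_ fun i h1 hi => ?_).trans rfl
  · exact ⟨h.fst_neg, h.snd_nonpos⟩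
  · exact h.notMem (i + 1) (by omega) (by omega)

/-- The orbit of the axis point `(0, c_{k+1})`, once it has entered the right half-plane. -/
theorem axis_orbit (hδL : 0 < P.δL) (hδR : 0 < P.δR) {b k : ℕ}
    (hB : ∀ k ≤ b, 0 < coefB P.τL P.δL (k + 1)) (hk : k ≤ b)
    (hpre : P.f (P.axisPt (k + 1)) ∈ P.PhiPre) :
    ∃ m, IsExit P.τR P.δR (level P.τL P.δL k) (m + 2) ∧
      P.Fpq (P.axisPt (k + 1)) = (axisX P.τR P.δR (m + 2) (level P.τL P.δL k),
        -P.δR * axisX P.τR P.δR (m + 1) (level P.τL P.δL k)) ∧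
      ∀ U, P.IsCrossing (P.Fpq (P.axisPt (k + 1))) U →
        ∃ s < 1, CrossAt P.τR P.δR (level P.τL P.δL k) m s U.2 := by
  set c := icept P.τL P.δL (k + 1) with hc
  set w := level P.τL P.δL k with hwdef
  have hw : 0 ≤ w := level_nonneg hδL hB k hk
  have hpt : P.axisPt (k + 1) = (0, c) := by rw [axisPt, intercept_eq]
  rw [hpt] at hpre ⊢
  have hleft : ∀ j ≤ k + 1, ((lin P.τL P.δL)^[j] (0, c)).1 ≤ 0 := fun j hj => by
    rw [lin_iterate_axis]; exact axisX_icept_nonpos hδL hB j k hj hk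
  have hfl : ∀ j ≤ k + 2, P.f^[j] (0, c) = (lin P.τL P.δL)^[j] (0, c) := fun j hj =>
    iterate_f_left fun i hi => hleft i (by omega)
  have hLw : (lin P.τL P.δL)^[k + 1] (0, c) = (0, w) := lin_iterate_icept hδL hB k hk
  have hfw : P.f^[k + 1] (0, c) = (0, w) := by rw [hfl _ (by omega), hLw]
  have hLw1 : (lin P.τL P.δL)^[k + 2] (0, c) = (w + 1, 0) := by
    rw [Function.iterate_succ_apply', hLw]; simp [lin]
  have hRw : ∀ n, (lin P.τR P.δR)^[n] (w + 1, 0) = (lin P.τR P.δR)^[n + 1] (0, w) := fun n => by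
    rw [Function.iterate_succ_apply]; simp [lin]
  -- Without an exit the orbit of f(S) or f(T) would miss Φ: ordinates are positive before it
  -- reaches (0,w), abscissas nonnegative from then on.
  have hex : ∃ n, axisX P.τR P.δR n w < 0 := by
    by_contra! hall
    obtain ⟨n, hn, hΦ⟩ := hpre
    rw [← Function.iterate_succ_apply, Nat.succ_eq_add_one] at hΦ
    rcases le_or_gt (n + 1) k with h | h
    · rw [hfl _ (by omega)] at hΦ
      have h2 := hΦ.2
      rw [lin_iterate_snd, lin_iterate_axis] at h2
      obtain ⟨n, rfl⟩ : ∃ n', n = n' + 1 := ⟨n - 1, by omega⟩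
      have := axisX_icept_neg hδL hB n k (by omega) hk
      nlinarith
    · obtain ⟨j, hj⟩ := Nat.exists_eq_add_of_lt h
      rw [show n + 1 = j + (k + 1) by omega, Function.iterate_add_apply, hfw,
        iterate_f_right fun i _ => by rw [lin_iterate_axis]; exact hall i] at hΦ
      have := hΦ.1
      rw [lin_iterate_axis] at this
      exact absurd this (not_lt.2 (hall j))
  classical
  have hE : IsExit P.τR P.δR w (Nat.find hex) :=
    ⟨fun i hi => not_lt.1 (Nat.find_min hex hi), Nat.find_spec hex⟩
  obtain ⟨m, hm⟩ := Nat.exists_eq_add_of_le' (hE.two_le hw)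
  rw [hm] at hE
  have hfr : ∀ n ≤ m + 1, P.f^[n] (w + 1, 0) = (lin P.τR P.δR)^[n + 1] (0, w) := fun n hn => by
    rw [← hRw]
    refine iterate_f_right fun i hi => ?_
    rw [hRw, lin_iterate_axis]
    exact hE.1 _ (by omega)
  have hχL : P.chiL (0, c) = k + 2 := by
    have : IsLeast {i : ℕ | 1 ≤ i ∧ P.f^[i] (0, c) ∉ PiL} (k + 2) := by
      refine ⟨⟨by omega, ?_⟩, fun i hi => ?_⟩
      · rw [hfl _ le_rfl, hLw1]
        simp only [PiL, mem_ofPred_eq]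
        linarith
      · by_contra! hlt
        refine hi.2 ?_
        rw [hfl _ (by omega)]
        exact hleft i (by omega)
    exact this.csInf_eq
  have hχR : P.chiR (w + 1, 0) = m + 1 := by
    have : IsLeast {j : ℕ | 1 ≤ j ∧ P.f^[j] (w + 1, 0) ∉ PiR} (m + 1) := by
      refine ⟨⟨by omega, ?_⟩, fun i hi => ?_⟩
      · rw [hfr _ le_rfl]
        simp only [PiR, mem_ofPred_eq, lin_iterate_axis, not_le]
        exact hE.2
      · by_contra! hlt
        refine hi.2 ?_
        rw [hfr _ (by omega)]
        simp only [PiR, mem_ofPred_eq, lin_iterate_axis]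
        exact hE.1 _ (by omega)
    exact this.csInf_eq
  have hF : P.Fpq (0, c) = (axisX P.τR P.δR (m + 2) w, -P.δR * axisX P.τR P.δR (m + 1) w) := by
    rw [Fpq, hχL, fL_eq_lin, hLw1, hχR, fR_eq_lin, hRw]
    ext
    · rw [lin_iterate_axis]
    · rw [lin_iterate_snd, lin_iterate_axis]
  refine ⟨m, hE, hF, ?_⟩
  rintro U ⟨X', hX', hU, hUs⟩
  rw [hF] at hX' hU
  have ha1 := hE.1 (m + 1) (by omega)
  have ha2 := hE.2
  have hrec := axisX_add_two P.τR P.δR m w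
  have hX : X' = (axisX P.τR P.δR (m + 1) w, -P.δR * axisX P.τR P.δR m w) := by
    obtain ⟨x, y⟩ := X'
    rcases le_or_gt x 0 with hx | hx
    · rw [f_of_nonpos hx, fL, Prod.mk.injEq] at hX'
      obtain ⟨h1, h2⟩ := hX'
      have hx0 : x = 0 := by
        by_contra hne
        have : x < 0 := lt_of_le_of_ne hx hne
        nlinarith
      have ha0 : axisX P.τR P.δR (m + 1) w = 0 := by
        subst hx0
        have : P.δR * axisX P.τR P.δR (m + 1) w = 0 := by linarith
        exact (mul_eq_zero.1 this).resolve_left hδR.ne'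
      simp only [hx0, ha0] at h1 hrec ⊢
      ext
      · rfl
      · linarith
    · rw [f_of_nonneg (Z := (x, y)) hx.le, fR, Prod.mk.injEq] at hX'
      obtain ⟨h1, h2⟩ := hX'
      have hx0 : x = axisX P.τR P.δR (m + 1) w := by
        have : P.δR * (x - axisX P.τR P.δR (m + 1) w) = 0 := by linarith
        have := (mul_eq_zero.1 this).resolve_left hδR.ne'
        linarith
      simp only [hx0] at h1 ⊢
      ext
      · rfl
      · simp only; linarith
  subst hX
  obtain ⟨r, rfl⟩ := mem_affineSpan_pair_iff_exists_lineMap_eq.1 hU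
  simp only [switching, mem_ofPred_eq, AffineMap.lineMap_apply, vsub_eq_sub, vadd_eq_add,
    Prod.fst_add, Prod.smul_fst, Prod.fst_sub, smul_eq_mul] at hUs
  refine ⟨1 - r, ?_, ?_, ?_, ?_, ?_⟩
  · by_contra! hr
    nlinarith
  · by_contra! hr
    nlinarith
  · by_contra! hr
    nlinarith
  · linear_combination hUs
  · simp only [AffineMap.lineMap_apply, vsub_eq_sub, vadd_eq_add, Prod.snd_add, Prod.smul_snd,
      Prod.snd_sub, smul_eq_mul]
    ring

theorem mem_Omega_iff {b a : ℕ} (hδL : 0 < P.δL)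
    (hB : ∀ k ≤ b, 0 < coefB P.τL P.δL (k + 1)) (hab : a < b) (Z : ℝ × ℝ) :
    Z ∈ P.Omega (a + 1) (b + 1) ↔ Z ∈ Phi ∧ chord (icept P.τL P.δL (b + 1)) Z ≤ 0 ∧
      0 ≤ chord (icept P.τL P.δL (a + 1)) Z := by
  have h1 := icept_le_neg_one hδL hB b le_rfl
  have h2 := icept_le_neg_one hδL hB a hab.le
  rw [Omega, mem_ofPred_eq, intercept_eq, intercept_eq, div_mul_eq_mul_div, div_mul_eq_mul_div,
    div_le_iff_of_neg (by linarith), le_div_iff_of_neg (by linarith)]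
  refine and_congr_right fun _ => and_congr ?_ ?_ <;> simp only [chord] <;>
    constructor <;> intro h <;> linarith

/-- Points of `Omega` return to `Phi`, strictly between the two chords. -/
theorem Omega_return (hδL : 0 < P.δL) (hδR : 0 < P.δR) {a b : ℕ}
    (hB : ∀ k ≤ b, 0 < coefB P.τL P.δL (k + 1)) (hab : a < b)
    (hfS : P.f (P.axisPt (b + 1)) ∈ P.PhiPre) (hfT : P.f (P.axisPt (a + 1)) ∈ P.PhiPre)
    {U V : ℝ × ℝ} (hU : P.IsCrossing (P.Fpq (P.axisPt (b + 1))) U)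
    (hV : P.IsCrossing (P.Fpq (P.axisPt (a + 1))) V)
    (hUS : icept P.τL P.δL (b + 1) < U.2) (hVT : V.2 < icept P.τL P.δL (a + 1))
    (hFS : chord (icept P.τL P.δL (b + 1)) (P.Fpq (P.axisPt (b + 1))) < 0)
    {Z : ℝ × ℝ} (hZ : Z ∈ P.Omega (a + 1) (b + 1)) :
    ∃ N, P.IsReturn Z N ∧ chord (icept P.τL P.δL (b + 1)) (P.f^[N + 1] Z) < 0 ∧
      0 < chord (icept P.τL P.δL (a + 1)) (P.f^[N + 1] Z) := by
  rw [mem_Omega_iff hδL hB hab] at hZ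
  obtain ⟨⟨hx, hy⟩, hZ1, hZ2⟩ := hZ
  have hcS := icept_le_neg_one hδL hB b le_rfl
  have hcT := icept_le_neg_one hδL hB a hab.le
  obtain ⟨mS, hES, hFpqS, hCS⟩ := axis_orbit hδL hδR hB le_rfl hfS
  obtain ⟨mT, hET, hFpqT, hCT⟩ := axis_orbit hδL hδR hB hab.le hfT
  obtain ⟨sS, hsS, hCS⟩ := hCS U hU
  obtain ⟨sT, hsT, hCT⟩ := hCT V hV
  rw [hFpqS] at hFS
  obtain ⟨p, hp1, hp2, hp3, hp4, hp5, hp6⟩ := left_passage hδL hB hab hx hy hZ1 hZ2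
  have hY : 0 ≤ ((lin P.τL P.δL)^[p + 1] Z).2 := by
    rw [lin_iterate_snd]; nlinarith
  have hT0 := level_nonneg hδL hB a hab.le
  have hST := level_mono hδL hB a b hab.le le_rfl
  have hS0 : 0 < level P.τL P.δL b := by
    obtain ⟨b', rfl⟩ : ∃ b', b = b' + 1 := ⟨b - 1, by omega⟩
    exact level_pos hδL hB b' le_rfl
  obtain ⟨w, t, hw1, hw2, ht0, ht1, hXt, hYt⟩ :=
    exists_strip_coord hp3 hY hT0 hS0 hST hp4 hp5 hp6
  have hw0 := hT0.trans hw1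
  classical
  have hex : ∃ n, axisX P.τR P.δR n w < 0 := ⟨_, hET.mono hT0 hw1⟩
  have hE : IsExit P.τR P.δR w (Nat.find hex) :=
    ⟨fun i hi => not_lt.1 (Nat.find_min hex hi), Nat.find_spec hex⟩
  obtain ⟨m, hm⟩ := Nat.exists_eq_add_of_le' (hE.two_le hw0)
  rw [hm] at hE
  obtain ⟨s, v, hs, hC⟩ := hE.exists_crossAt
  have hv2 : v < icept P.τL P.δL (a + 1) := (hET.cross_le hδR hT0 hw1 hE hCT hC).trans_lt hVT
  obtain ⟨hv1, hX⟩ := hE.inside hδR hw0 hw2 hES hC hCS hcS hUS hFS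
  obtain ⟨r, hr1, hr2, hr3, hr4, hr5⟩ :=
    hE.exit_point hδR hw0 ht0 ht1 hC hs hv1 hv2 hcT hX
  have hZt : (lin P.τL P.δL)^[p + 1] Z = (t * (w + 1), (1 - t) * w) := Prod.ext hXt hYt
  have hle : ∀ j ≤ p, ((lin P.τL P.δL)^[j] Z).1 ≤ 0 := fun j hj => by
    obtain hj | rfl := hj.lt_or_eq
    · exact (hp1 j hj).le
    · exact hp2
  have hfl : ∀ j ≤ p + 1, P.f^[j] Z = (lin P.τL P.δL)^[j] Z := fun j hj =>
    iterate_f_left fun i hi => hle i (by omega)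
  have hfr : ∀ j ≤ r + 1, P.f^[p + 1 + j] Z =
      (lin P.τR P.δR)^[j] (t * (w + 1), (1 - t) * w) := fun j hj => by
    rw [add_comm, Function.iterate_add_apply, hfl _ le_rfl, hZt]
    refine iterate_f_right fun i hi => ?_
    obtain hi | rfl := (Nat.lt_succ_iff_lt_or_eq.1 (by omega : i < r + 1))
    · exact (hr1 i hi).le
    · exact hr2
  have hN : P.f^[p + 1 + r + 1] Z = _ := hfr (r + 1) le_rfl
  have h0 : 0 ≤ (P.f^[p + 1 + r] Z).1 := by rw [hfr r (by omega)]; exact hr2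
  refine ⟨p + 1 + r, ⟨by omega, fun i h1 hi => ?_, h0, ?_, iterate_f_snd_nonpos hδR h0⟩, ?_, ?_⟩
  · rcases lt_or_ge i (p + 1) with h | h
    · right
      obtain ⟨i, rfl⟩ : ∃ i', i = i' + 1 := ⟨i - 1, by omega⟩
      refine iterate_f_snd_pos hδL ?_
      rw [hfl _ (by omega)]
      exact hp1 i (by omega)
    · left
      obtain ⟨j, rfl⟩ := Nat.exists_eq_add_of_le h
      rw [hfr _ (by omega)]
      exact hr1 j (by omega)
  · rw [hN]; exact hr3
  · rw [hN]; exact hr4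
  · rw [hN]; exact hr5

end orbits
/-! ### The cylindrical topology -/

section cylinder

variable {P : BCNF}

theorem exists_open_of_saturated {pmin pmax : ℕ} {G : Set Q3} (hG : IsOpen G)
    (hsat : ∀ X Y, P.glue pmin pmax X Y → (X ∈ G ↔ Y ∈ G)) :
    ∃ O : Set (P.Cyl pmin pmax), IsOpen O ∧ ∀ X, P.toCyl pmin pmax X ∈ O ↔ X ∈ G := by
  refine ⟨{q | Quot.lift (fun X => X ∈ G) (fun X Y h => propext (hsat X Y h)) q}, ?_,
    fun X => Iff.rfl⟩
  exact isQuotientMap_quot_mk.isOpen_preimage.1 hG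

theorem continuous_toCyl (pmin pmax : ℕ) : Continuous (P.toCyl pmin pmax) := continuous_quot_mk

theorem continuous_chord (c : ℝ) : Continuous (chord c) := by
  unfold chord; fun_prop

variable {a b : ℕ} (hδL : 0 < P.δL) (hB : ∀ k ≤ b, 0 < coefB P.τL P.δL (k + 1)) (hab : a < b)
include hδL hB hab

theorem mem_interior_OmegaCyl {X : Q3}
    (h1 : chord (icept P.τL P.δL (b + 1)) X.1 < 0)
    (h2 : 0 < chord (icept P.τL P.δL (a + 1)) X.1) :
    P.toCyl (a + 1) (b + 1) X ∈ interior (P.OmegaCyl (a + 1) (b + 1)) := by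
  have hcS : icept P.τL P.δL (b + 1) < -1 := by
    obtain ⟨b', rfl⟩ : ∃ b', b = b' + 1 := ⟨b - 1, by omega⟩
    exact icept_lt_neg_one hδL hB b' le_rfl
  have hcT := icept_le_neg_one hδL hB a hab.le
  set cS := icept P.τL P.δL (b + 1)
  set cT := icept P.τL P.δL (a + 1)
  have hchord := continuous_chord
  -- The alternative on the ordinate matters when cT = -1: that chord is the y-axis, so `chord cT`
  -- vanishes on the glued segment.
  let G : Set Q3 := {X | chord cS X.1 < 0 ∧ (0 < chord cT X.1 ∨ X.1.2 < cT)}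
  have hG : IsOpen G :=
    (isOpen_lt ((hchord cS).comp continuous_subtype_val) continuous_const).inter
      ((isOpen_lt continuous_const ((hchord cT).comp continuous_subtype_val)).union
        (isOpen_lt (continuous_snd.comp continuous_subtype_val) continuous_const))
  have hsat : ∀ X Y, P.glue (a + 1) (b + 1) X Y → (X ∈ G ↔ Y ∈ G) := by
    rintro ⟨⟨x, y⟩, hX⟩ ⟨Y, hY⟩ ⟨h0, h1, h2, h3⟩
    simp only [switching, mem_ofPred_eq, intercept_eq] at h0 h1 h2 h3
    subst h0
    rw [f_axis] at h3
    subst h3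
    simp only [G, mem_ofPred_eq, chord]
    constructor
    · rintro ⟨u, v⟩
      have hy : cS < y := by by_contra! hn; nlinarith
      have hy' : y < cT := by
        rcases v with v | v
        · by_contra! hn
          nlinarith
        · exact v
      exact ⟨by nlinarith, Or.inl (by nlinarith)⟩
    · rintro ⟨u, v⟩
      have hy : cS < y := by by_contra! hn; nlinarith
      have hy' : y < cT := by
        rcases v with v | v
        · by_contra! hn
          nlinarith
        · linarith
      exact ⟨by nlinarith, Or.inr hy'⟩
  obtain ⟨O, hO, hOG⟩ := exists_open_of_saturated hG hsat
  refine mem_interior.2 ⟨O, ?_, hO, (hOG X).2 ⟨h1, Or.inl h2⟩⟩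
  intro q hq
  obtain ⟨Y, rfl⟩ := Quot.exists_rep q
  have hYG : Y ∈ G := (hOG Y).1 hq
  have key : ∀ Y : Q3, Y ∈ G → Y.1.1 < 0 → Y.1 ∈ P.Omega (a + 1) (b + 1) := by
    rintro ⟨⟨x, y⟩, hY⟩ ⟨u, v⟩ hx
    refine (mem_Omega_iff hδL hB hab _).2 ⟨⟨hx, hY.2⟩, u.le, ?_⟩
    rcases v with v | v
    · exact v.le
    · simp only [chord] at v hx ⊢
      nlinarith
  rcases hY0 : Y with ⟨⟨x, y⟩, hYQ⟩
  rcases (show x ≤ 0 from hYQ.1).lt_or_eq with hx | rfl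
  · rw [← hY0]
    exact ⟨Y, key Y hYG (by rw [hY0]; exact hx), rfl⟩
  · subst hY0
    obtain ⟨u, v⟩ := id hYG
    simp only [chord] at u v
    have hy : cS < y := by by_contra! hn; nlinarith
    have hy' : y < cT := by
      rcases v with v | v
      · by_contra! hn
        nlinarith
      · exact v
    have hQ : ((y + 1, 0) : ℝ × ℝ) ∈ Q3 := ⟨by simp only; linarith, le_rfl⟩
    have hgl : P.glue (a + 1) (b + 1) ⟨(0, y), hYQ⟩ ⟨(y + 1, 0), hQ⟩ := by
      refine ⟨rfl, ?_, ?_, (f_axis y).symm⟩ <;> rw [intercept_eq]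
      · exact hy.le
      · exact hy'.le
    have e : Quot.mk (P.glue (a + 1) (b + 1)) ⟨(0, y), hYQ⟩ = Quot.mk _ ⟨(y + 1, 0), hQ⟩ :=
      Quot.sound hgl
    rw [e]
    exact ⟨_, key ⟨(y + 1, 0), hQ⟩ ((hsat _ _ hgl).1 hYG) (by simp only; linarith), rfl⟩

/-- Neighbourhoods of a point of `Omega` in the cylinder. -/
theorem exists_open_cyl {Z : ℝ × ℝ} (hZ : Z ∈ Phi) {A : Set (ℝ × ℝ)} (hA : IsOpen A)
    (hZA : Z ∈ A) :
    ∃ O : Set (P.Cyl (a + 1) (b + 1)), IsOpen O ∧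
      (∀ h, P.toCyl (a + 1) (b + 1) ⟨Z, h⟩ ∈ O) ∧
      ∀ Z' h, P.toCyl (a + 1) (b + 1) ⟨Z', h⟩ ∈ O → Z' ∈ A ∨ P.f Z' ∈ A := by
  have hcT := icept_le_neg_one hδL hB a hab.le
  rcases (show Z.2 ≤ 0 from hZ.2).lt_or_eq with hZ2 | hZ2
  · let G : Set Q3 := {X | X.1 ∈ A ∧ X.1.1 < 0 ∧ X.1.2 < 0}
    have hG : IsOpen G := (hA.preimage continuous_subtype_val).inter
      ((isOpen_lt (continuous_fst.comp continuous_subtype_val) continuous_const).inter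
        (isOpen_lt (continuous_snd.comp continuous_subtype_val) continuous_const))
    obtain ⟨O, hO, hOG⟩ := exists_open_of_saturated (P := P) (pmin := a + 1) (pmax := b + 1) hG (by
      rintro ⟨⟨x, y⟩, hX⟩ ⟨Y, hY⟩ ⟨h0, h1, h2, h3⟩
      simp only [switching, mem_ofPred_eq] at h0 h3
      subst h0
      rw [f_axis] at h3
      subst h3
      simp [G])
    exact ⟨O, hO, fun h => (hOG _).2 ⟨hZA, hZ.1, hZ2⟩, fun Z' h hm => Or.inl ((hOG _).1 hm).1⟩
  -- A point of the x-axis also has neighbours near its glued partner on the y-axis, detected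
  -- through their images; the diagonal separates the two pieces.
  · let G : Set Q3 := {X | (X.1 ∈ A ∧ X.1.1 < X.1.2 ∧ X.1.1 < 0) ∨
      (P.f X.1 ∈ A ∧ X.1.2 < X.1.1 ∧ (P.f X.1).1 < 0)}
    have c1 : Continuous fun X : Q3 => X.1.1 := continuous_fst.comp continuous_subtype_val
    have c2 : Continuous fun X : Q3 => X.1.2 := continuous_snd.comp continuous_subtype_val
    have cf : Continuous fun X : Q3 => P.f X.1 := continuous_f.comp continuous_subtype_val
    have hG : IsOpen G :=
      ((hA.preimage continuous_subtype_val).inter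
        ((isOpen_lt c1 c2).inter (isOpen_lt c1 continuous_const))).union
      ((hA.preimage cf).inter
        ((isOpen_lt c2 c1).inter (isOpen_lt (continuous_fst.comp cf) continuous_const)))
    obtain ⟨O, hO, hOG⟩ := exists_open_of_saturated (P := P) (pmin := a + 1) (pmax := b + 1) hG (by
      rintro ⟨⟨x, y⟩, hX⟩ ⟨Y, hY⟩ ⟨h0, h1, h2, h3⟩
      simp only [switching, mem_ofPred_eq, intercept_eq] at h0 h2 h3
      subst h0
      rw [f_axis] at h3
      subst h3
      simp only [G, mem_ofPred_eq, f_axis]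
      constructor
      · rintro (⟨-, -, h⟩ | ⟨h, -, h'⟩)
        · exact absurd h (lt_irrefl _)
        · exact Or.inl ⟨h, h', h'⟩
      · rintro (⟨h, -, h'⟩ | ⟨-, h, -⟩)
        · exact Or.inr ⟨h, by linarith, h'⟩
        · linarith)
    refine ⟨O, hO, fun h => (hOG _).2 (Or.inl ⟨hZA, hZ2 ▸ hZ.1, hZ.1⟩), fun Z' h hm => ?_⟩
    rcases (hOG _).1 hm with h | h
    · exact Or.inl h.1
    · exact Or.inr h.1

/-- Away from the gluing the return map varies continuously; at a jump of the return time the two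
candidate images are glued. -/
theorem IsReturn.eventually_mem (hδR : 0 < P.δR) {Z : ℝ × ℝ} {N : ℕ} (h : P.IsReturn Z N)
    (h1 : chord (icept P.τL P.δL (b + 1)) (P.f^[N + 1] Z) < 0)
    (h2 : 0 < chord (icept P.τL P.δL (a + 1)) (P.f^[N + 1] Z))
    {O : Set (P.Cyl (a + 1) (b + 1))} (hO : IsOpen O)
    (hZO : ∀ hq, P.toCyl (a + 1) (b + 1) ⟨P.F Z, hq⟩ ∈ O) :
    ∀ᶠ Z' in 𝓝 Z, ∀ hq, P.toCyl (a + 1) (b + 1) ⟨P.F Z', hq⟩ ∈ O := by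
  have hcS := icept_le_neg_one hδL hB b le_rfl
  have hcT := icept_le_neg_one hδL hB a hab.le
  obtain ⟨A, hA, hAO⟩ := isOpen_induced_iff.1 (hO.preimage (continuous_toCyl (a + 1) (b + 1)))
  have hmem : ∀ X (hq : X ∈ Q3), X ∈ A ↔ P.toCyl (a + 1) (b + 1) ⟨X, hq⟩ ∈ O := fun X hq => by
    change (⟨X, hq⟩ : Q3) ∈ Subtype.val ⁻¹' A ↔ _
    rw [hAO]; rfl
  have hcont : ∀ n, Continuous P.f^[n] := fun n => continuous_f.iterate n
  have hZA : P.f^[N + 1] Z ∈ A := by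
    rw [h.F_eq] at hZO
    exact (hmem _ ⟨h.fst_neg.le, h.snd_nonpos⟩).2 (hZO _)
  have ev1 : ∀ᶠ Z' in 𝓝 Z, P.f^[N + 1] Z' ∈ A :=
    (hcont (N + 1)).continuousAt (hA.mem_nhds hZA)
  have ev2 : ∀ᶠ Z' in 𝓝 Z, (P.f^[N + 1] Z').1 < 0 :=
    (continuous_fst.comp (hcont (N + 1))).continuousAt (isOpen_Iio.mem_nhds h.fst_neg)
  have ev3 : ∀ᶠ Z' in 𝓝 Z, ∀ i ∈ Finset.range N, 1 ≤ i →
      0 < (P.f^[i] Z').1 ∨ 0 < (P.f^[i] Z').2 := by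
    rw [Filter.eventually_all_finset]
    intro i hi
    by_cases h1 : 1 ≤ i
    · simp only [h1, true_imp_iff]
      rcases h.avoid i h1 (Finset.mem_range.1 hi) with hp | hp
      · have : ∀ᶠ Z' in 𝓝 Z, 0 < (P.f^[i] Z').1 :=
          (continuous_fst.comp (hcont i)).continuousAt (isOpen_Ioi.mem_nhds hp)
        exact this.mono fun _ => Or.inl
      · have : ∀ᶠ Z' in 𝓝 Z, 0 < (P.f^[i] Z').2 :=
          (continuous_snd.comp (hcont i)).continuousAt (isOpen_Ioi.mem_nhds hp)
        exact this.mono fun _ => Or.inr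
    · exact .of_forall fun _ h => absurd h h1
  have late : ∀ Z', P.f^[N + 1] Z' ∈ A → (P.f^[N + 1] Z').1 < 0 →
      (∀ i ∈ Finset.range N, 1 ≤ i → 0 < (P.f^[i] Z').1 ∨ 0 < (P.f^[i] Z').2) →
      0 ≤ (P.f^[N] Z').1 → ∀ hq, P.toCyl (a + 1) (b + 1) ⟨P.F Z', hq⟩ ∈ O := by
    intro Z' e1 e2 e3 e4 hq
    have hR : P.IsReturn Z' N := ⟨h.one_le, fun i h1 hi => e3 i (Finset.mem_range.2 hi) h1, e4, e2,
      iterate_f_snd_nonpos hδR e4⟩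
    rw [← hmem, hR.F_eq]
    exact e1
  rcases h.fst_nonneg.lt_or_eq with hpos | hzero
  · have ev4 : ∀ᶠ Z' in 𝓝 Z, 0 < (P.f^[N] Z').1 :=
      (continuous_fst.comp (hcont N)).continuousAt (isOpen_Ioi.mem_nhds hpos)
    filter_upwards [ev1, ev2, ev3, ev4] with Z' e1 e2 e3 e4
    exact late Z' e1 e2 e3 e4.le
  -- Nearby points return at time N or N + 1, with images near (0,v) or (v+1,0), which are glued
  -- since v lies strictly between the intercepts.
  · obtain ⟨v, hv⟩ : ∃ v, P.f^[N] Z = (0, v) := ⟨(P.f^[N] Z).2, Prod.ext hzero.symm rfl⟩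
    have hv1 : P.f^[N + 1] Z = (v + 1, 0) := by
      rw [Function.iterate_succ_apply', hv, f_axis]
    rw [hv1] at h1 h2
    simp only [chord] at h1 h2
    have hvS : icept P.τL P.δL (b + 1) < v := by by_contra! hn; nlinarith
    have hvT : v < icept P.τL P.δL (a + 1) := by by_contra! hn; nlinarith
    have hq0 : ((0, v) : ℝ × ℝ) ∈ Q3 := ⟨le_rfl, by simp only; linarith⟩
    have hq1 : ((v + 1, 0) : ℝ × ℝ) ∈ Q3 := ⟨by simp only; linarith, le_rfl⟩
    have hgl : P.glue (a + 1) (b + 1) ⟨(0, v), hq0⟩ ⟨(v + 1, 0), hq1⟩ := by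
      refine ⟨rfl, ?_, ?_, (f_axis v).symm⟩ <;> rw [intercept_eq]
      · exact hvS.le
      · exact hvT.le
    have hvA : ((0, v) : ℝ × ℝ) ∈ A := by
      rw [hmem _ hq0, toCyl, Quot.sound hgl]
      rw [hv1] at hZA
      exact (hmem _ hq1).1 hZA
    have ev4 : ∀ᶠ Z' in 𝓝 Z, P.f^[N] Z' ∈ A :=
      (hcont N).continuousAt (hA.mem_nhds (hv ▸ hvA))
    have ev5 : ∀ᶠ Z' in 𝓝 Z, (P.f^[N] Z').2 < 0 :=
      (continuous_snd.comp (hcont N)).continuousAt (isOpen_Iio.mem_nhds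
        (by simp only [Function.comp, hv, mem_Iio]; linarith))
    filter_upwards [ev1, ev2, ev3, ev4, ev5] with Z' e1 e2 e3 e4 e5
    rcases le_or_gt 0 (P.f^[N] Z').1 with h0 | h0
    · exact late Z' e1 e2 e3 h0
    · intro hq
      have hF : P.F Z' = P.f^[N] Z' := F_eq_iterate h.one_le ⟨h0, e5.le⟩ fun i hi hiN hΦ => by
        rcases e3 i (Finset.mem_range.2 hiN) hi with h3 | h3
        · exact absurd hΦ.1 (not_lt.2 h3.le)
        · exact absurd hΦ.2 (not_le.2 h3)
      rw [← hmem, hF]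
      exact e4

end cylinder
end BCNF

open BCNF in
theorem proposition4p2 (P : BCNF)
    (hτL : 0 < P.τL) (hδL : 0 < P.δL) (hδR : 0 < P.δR)
    (pmin pmax : ℕ) (hpmin : 1 ≤ pmin) (hlt : pmin < pmax) (hpmax : (pmax : ℕ∞) ≤ P.pStar)
    (S T : ℝ × ℝ) (hS : S = P.axisPt pmax) (hT : T = P.axisPt pmin)
    (hfS : P.f S ∈ P.PhiPre) (hfT : P.f T ∈ P.PhiPre)
    (U V : ℝ × ℝ) (hU : P.IsCrossing (P.Fpq S) U) (hV : P.IsCrossing (P.Fpq T) V)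
    (hUS : S.2 < U.2) (hVT : V.2 < T.2)
    (hFS : (P.f S).1 * (P.Fpq S).2 + S.2 * (P.Fpq S).1 < (P.f S).1 * S.2)
    (hFT : (P.f T).1 * (P.Fpq T).2 + T.2 * (P.Fpq T).1 > (P.f T).1 * T.2) :
    P.Omega pmin pmax ⊆ P.Phi0 ∧
    ∃ hF : Set.MapsTo P.F (P.Omega pmin pmax) (P.Omega pmin pmax),
      @Continuous _ _ (P.cylTopology pmin pmax) (P.cylTopology pmin pmax)
        (hF.restrict P.F (P.Omega pmin pmax) (P.Omega pmin pmax)) ∧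
      ∀ Z : P.Omega pmin pmax,
        P.toCyl pmin pmax ⟨P.F Z.1, P.Omega_subset_Q3 pmin pmax (hF Z.2)⟩ ∈
          interior (P.OmegaCyl pmin pmax) := by
  obtain ⟨a, rfl⟩ : ∃ a, pmin = a + 1 := ⟨pmin - 1, by omega⟩
  obtain ⟨b, rfl⟩ : ∃ b, pmax = b + 1 := ⟨pmax - 1, by omega⟩
  subst hS hT
  have hab : a < b := by omega
  have hB := P.coefB_pos_of_le_pStar hpmax
  have hS2 : (P.axisPt (b + 1)).2 = icept P.τL P.δL (b + 1) := intercept_eq P _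
  have hT2 : (P.axisPt (a + 1)).2 = icept P.τL P.δL (a + 1) := intercept_eq P _
  have hfS1 : (P.f (P.axisPt (b + 1))).1 = icept P.τL P.δL (b + 1) + 1 := by
    rw [axisPt, f_axis, intercept_eq]
  rw [hS2] at hUS hFS
  rw [hT2] at hVT
  rw [hfS1] at hFS
  have hret : ∀ Z ∈ P.Omega (a + 1) (b + 1), ∃ N, P.IsReturn Z N ∧
      chord (icept P.τL P.δL (b + 1)) (P.f^[N + 1] Z) < 0 ∧
      0 < chord (icept P.τL P.δL (a + 1)) (P.f^[N + 1] Z) := fun Z hZ =>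
    Omega_return hδL hδR hB hab hfS hfT hU hV hUS hVT (by simp only [chord]; linarith) hZ
  have hF : MapsTo P.F (P.Omega (a + 1) (b + 1)) (P.Omega (a + 1) (b + 1)) := by
    intro Z hZ
    obtain ⟨N, h, h1, h2⟩ := hret Z hZ
    rw [h.F_eq]
    exact (mem_Omega_iff hδL hB hab _).2 ⟨⟨h.fst_neg, h.snd_nonpos⟩, h1.le, h2.le⟩
  refine ⟨fun Z hZ => ?_, hF, ?_, fun Z => ?_⟩
  · obtain ⟨N, h, -, -⟩ := hret Z hZ
    exact ⟨⟨N + 1, by omega, h.fst_neg, h.snd_nonpos⟩, hZ.1⟩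
  · let := P.cylTopology (a + 1) (b + 1)
    refine continuous_induced_rng.2 (continuous_def.2 fun O hO => ?_)
    rw [isOpen_iff_forall_mem_open]
    intro Z hZ
    obtain ⟨N, h, h1, h2⟩ := hret Z.1 Z.2
    obtain ⟨A, hAsub, hA, hZA⟩ := eventually_nhds_iff.1
      (h.eventually_mem hδL hB hab hδR h1 h2 hO fun hq => hZ)
    obtain ⟨O', hO', hZO', hsub⟩ := exists_open_cyl hδL hB hab Z.2.1 hA hZA
    refine ⟨_, fun Z' hZ' => ?_, isOpen_induced hO', hZO' _⟩
    -- A cylinder neighbour lies near Z itself or has its image near Z; `IsReturn.F_f` settles the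
    -- second case.
    rcases hsub Z'.1 _ hZ' with hm | hm
    · exact hAsub _ hm _
    · obtain ⟨N', h', -, -⟩ := hret Z'.1 Z'.2
      have := hAsub _ hm
      rw [h'.F_f] at this
      exact this _
  · obtain ⟨N, h, h1, h2⟩ := hret Z.1 Z.2
    rw [← h.F_eq] at h1 h2
    exact mem_interior_OmegaCyl hδL hB hab h1 h2
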